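/- **Setting and definitions.** Let $(X,d_X,\mu)$ and $(Y,d_Y,\nu)$ be complete, separable, locally compact, path-connected metric spaces with Radon measures such that $\operatorname{supp}\mu=X$ and $\operatorname{supp}\nu=Y$. * A *Lipschitz-isomorphism* is a map $\varphi:X\to Y$ with $\varphi_*\mu=\nu$ (push-forward) and $C^{-1}d_X(x,y)\le d_Y(\varphi(x),\varphi(y))\le C\,d_X(x,y)$ for all $x,y\in X$ and some $C\in[1,\infty)$. Such a map is automatically a homeomorphism, and $\varphi_*f:=f\circ\varphi$ defines an isometric isomorphism $\varphi_*:L^2(Y,\nu)\to L^2(X,\mu)$ of real $L^2$-spaces. For a partially defined linear operator $A$ on $L^2(X,\mu)$ the transported operator is $\varphi_{\mathbb L}A:=\varphi_*^{-1}A\varphi_*$ with domain $\varphi_*^{-1}(\mathcal D(A))$. * *Standing assumptions on $A$*: $A$ is densely defined and self-adjoint on $L^2(X,\mu)$; its spectrum lies in $[0,\infty)$ and its eigenvalues, repeated according to geometric multiplicity, form a sequence $0\le\lambda_1\le\lambda_2\le\dots$ with $\lambda_n\to\infty$; $\mathcal D(\sqrt A)\cap C_c(X)$ is dense in $C_c(X)$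 for the sup-norm and in $\mathcal D(\sqrt A)$ for the graph norm $\|f\|+\|\sqrt A f\|$; and $\|(\lambda+A)f\|\ge\lambda\|f\|$ for all $f\in\mathcal D(A)$, $\lambda>0$. * $\dim_S(X,A):=\lim_{x\to\infty}\frac{\log N_A(x)}{\log x}$ with $N_A(x):=\max\{n:\lambda_n\le x\}$. * A *Hunt process associated to $A$* is a time-homogeneous strong Markov process $M=((M_t)_{t\ge0},(\mathbb P_x)_{x\in X_*})$ with values in $X_*=X\sqcup\{*\}$ (the one-point compactification of $X$ if $X$ is non-compact; $*$ an isolated point if $X$ is compact), with $\mathbb P_x[M_0=x]=1$ and $\mathbb P_*[M_t=*]=1$, with right-continuous trajectories having left limits, quasi-left-continuous with respect to the filtration $\mathcal F_t=\bigcap_{\mathbb P}\sigma\{M_s:s\le t\}^{\mathbb P}$ (completions, over all probability measures $\mathbb P$ on the sample space), such that for all $t\geq 0$ and all bounded Borel $f\in L^2(X,\mu)$, with the convention $f(*)=0$, $x\mapsto\mathbb E_x[f(M_t)]$ is a version of $T_tf$. Here $(T_t)_{t\ge0}$ is the strongly continuous contraction semigroup on $L^2(X,\mu)$ with generator $-A$,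 i.e. the one belonging to the form $\langle\sqrt A\,\cdot,\sqrt A\,\cdot\rangle$. * $\dim_W(X,M)=d$ means that for $\mu$-almost every $x$, $\lim_{r\searrow0}\frac{\log\mathbb E_x[\tau(B(x,r))]}{\log r}=d$, where $\tau(B(x,r))=\inf\{t\ge0:M_t\notin B(x,r)\}$. * The *Einstein relation with constant $c\in\mathbb R$ holds on $X$ with respect to $A$ (and $M$)* if $\dim_S(X,A)$ and $\dim_W(X,M)$ exist (as extended real numbers) and $\dim_H(X)=c\,\dim_S(X,A)\,\dim_W(X,M)$. **Proposition.** Let $\varphi:X\to Y$ be a Lipschitz-isomorphism, let $A$ be an operator on $L^2(X,\mu)$ satisfying the standing assumptions, let $M$ be a Hunt process associated to $A$, and suppose that the Einstein relation with constant $c$ holds on $X$ with respect to $A$ and $M$. Then $\varphi_{\mathbb L}A$ satisfies the standing assumptions on $L^2(Y,\nu)$; the image process $\varphi(M)$ (with $\varphi(*)=*$ and laws $\mathbb P_{\varphi^{-1}(y)}$) is a Hunt process associated to $\varphi_{\mathbb L}A$; $\dim_H(Y)=\dim_H(X)$ and $\dim_S(Y,\varphi_{\mathbb L}A)=\dim_S(X,A)$;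 and for every Hunt process $N$ associated to $\varphi_{\mathbb L}A$ one has $\dim_W(Y,N)=\dim_W(X,M)$, and the Einstein relation holds on $Y$ with the same constant $c$ with respect to $\varphi_{\mathbb L}A$ and $N$. -/

import Mathlib

open MeasureTheory ProbabilityTheory Filter Topology Set
open scoped NNReal ENNReal CompactlySupported

noncomputable section

namespace EinsteinRel

/-! ### Lipschitz-isomorphisms of metric measure spaces and transport of operators -/

section Transport

variable {X Y : Type*} [MetricSpace X] [MeasurableSpace X] [MetricSpace Y] [MeasurableSpace Y]

/-- A Lipschitz-isomorphism `φ : (X, d_X, μ) → (Y, d_Y, ν)` between metric measure spaces of full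
support: it pushes `μ` forward to `ν` and is bi-Lipschitz. Surjectivity is not part of the
definition. -/
structure IsLipschitzIso (φ : X → Y) (μ : Measure X) (ν : Measure Y) : Prop where
  map_eq : Measure.map φ μ = ν
  biLipschitz : ∃ C : ℝ, 1 ≤ C ∧ ∀ x y : X,
    1 / C * dist x y ≤ dist (φ x) (φ y) ∧ dist (φ x) (φ y) ≤ C * dist x y

variable {φ : X → Y} {μ : Measure X} {ν : Measure Y}

lemma IsLipschitzIso.isClosedEmbedding [CompleteSpace X] (h : IsLipschitzIso φ μ ν) :
    IsClosedEmbedding φ := by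
  obtain ⟨C, hC, hd⟩ := h.biLipschitz
  have hC0 : (0 : ℝ) < C := by linarith
  have hL : LipschitzWith (Real.toNNReal C) φ := by
    refine LipschitzWith.of_dist_le_mul fun x y => ?_
    rw [Real.coe_toNNReal _ hC0.le]
    exact (hd x y).2
  have hA : AntilipschitzWith (Real.toNNReal C) φ := by
    refine AntilipschitzWith.of_le_mul_dist fun x y => ?_
    rw [Real.coe_toNNReal _ hC0.le]
    have := (hd x y).1
    rw [one_div, inv_mul_le_iff₀ hC0] at this
    exact this
  exact hA.isClosedEmbedding hL.uniformContinuous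

variable [BorelSpace X] [BorelSpace Y]

lemma IsLipschitzIso.measurePreserving [CompleteSpace X] (h : IsLipschitzIso φ μ ν) :
    MeasurePreserving φ μ ν :=
  ⟨h.isClosedEmbedding.continuous.measurable, h.map_eq⟩

lemma IsLipschitzIso.surjective [CompleteSpace X] [ν.IsOpenPosMeasure]
    (h : IsLipschitzIso φ μ ν) : Function.Surjective φ := by
  have hcl := h.isClosedEmbedding.isClosed_range
  have h0 : ν (range φ)ᶜ = 0 := by
    rw [← h.measurePreserving.measure_preimage hcl.measurableSet.compl.nullMeasurableSet]
    simp
  have := (hcl.isOpen_compl.measure_eq_zero_iff ν).1 h0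
  rwa [compl_empty_iff, range_eq_univ] at this

/-- The homeomorphism underlying a Lipschitz-isomorphism. -/
def IsLipschitzIso.homeomorph [CompleteSpace X] [ν.IsOpenPosMeasure]
    (h : IsLipschitzIso φ μ ν) : X ≃ₜ Y :=
  h.isClosedEmbedding.isEmbedding.toHomeomorphOfSurjective h.surjective

lemma IsLipschitzIso.coe_homeomorph [CompleteSpace X] [ν.IsOpenPosMeasure]
    (h : IsLipschitzIso φ μ ν) : (h.homeomorph : X → Y) = φ := rfl

lemma IsLipschitzIso.measurePreserving_symm [CompleteSpace X] [ν.IsOpenPosMeasure]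
    (h : IsLipschitzIso φ μ ν) : MeasurePreserving h.homeomorph.symm ν μ := by
  have h1 : MeasurePreserving h.homeomorph.toMeasurableEquiv μ ν := h.measurePreserving
  exact h1.symm

/-- The isometric isomorphism `φ_* : L²(Y, ν) → L²(X, μ)`, `f ↦ f ∘ φ`. -/
def IsLipschitzIso.pullback [CompleteSpace X] [ν.IsOpenPosMeasure] (h : IsLipschitzIso φ μ ν) :
    Lp ℝ 2 ν ≃ₗᵢ[ℝ] Lp ℝ 2 μ :=
  LinearIsometryEquiv.ofSurjective (Lp.compMeasurePreservingₗᵢ ℝ φ h.measurePreserving) (by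
    intro g
    refine ⟨Lp.compMeasurePreserving h.homeomorph.symm h.measurePreserving_symm g, ?_⟩
    apply Lp.ext
    have h1 := Lp.coeFn_compMeasurePreserving
      (Lp.compMeasurePreserving h.homeomorph.symm h.measurePreserving_symm g) h.measurePreserving
    have h2 := h.measurePreserving.quasiMeasurePreserving.ae
      (Lp.coeFn_compMeasurePreserving g h.measurePreserving_symm)
    filter_upwards [h1, h2] with x hx1 hx2
    refine hx1.trans (hx2.trans ?_)
    exact congrArg g (h.homeomorph.symm_apply_apply x))

/-- The transported operator `φ_L A = φ_*⁻¹ ∘ A ∘ φ_*` with domain `φ_*⁻¹ (D(A))`. -/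
def IsLipschitzIso.transport [CompleteSpace X] [ν.IsOpenPosMeasure] (h : IsLipschitzIso φ μ ν)
    (A : Lp ℝ 2 μ →ₗ.[ℝ] Lp ℝ 2 μ) : Lp ℝ 2 ν →ₗ.[ℝ] Lp ℝ 2 ν where
  domain := A.domain.comap (h.pullback.toLinearEquiv : Lp ℝ 2 ν →ₗ[ℝ] Lp ℝ 2 μ)
  toFun := (h.pullback.symm.toLinearEquiv : Lp ℝ 2 μ →ₗ[ℝ] Lp ℝ 2 ν) ∘ₗ A.toFun ∘ₗ
    (h.pullback.toLinearEquiv : Lp ℝ 2 ν →ₗ[ℝ] Lp ℝ 2 μ).restrict (fun _ hf => hf)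

end Transport

/-! ### Operators on a Hilbert space: spectrum, eigenvalues, square root, semigroup -/

section Operators

variable {H : Type*} [NormedAddCommGroup H] [InnerProductSpace ℝ H]

/-- `z` is in the resolvent set of `A`: the operator `z - A : D(A) → H` has an everywhere defined
bounded two-sided inverse. -/
def IsResolventPoint (A : H →ₗ.[ℝ] H) (z : ℝ) : Prop :=
  ∃ R : H →L[ℝ] H,
    (∀ f : H, ∃ hf : R f ∈ A.domain, z • R f - A ⟨R f, hf⟩ = f) ∧
    ∀ u : A.domain, R (z • (u : H) - A u) = u

/-- The spectrum of a partially defined operator. -/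
def opSpectrum (A : H →ₗ.[ℝ] H) : Set ℝ := {z | ¬ IsResolventPoint A z}

/-- The eigenspace `{u ∈ D(A) : A u = a u}`. -/
def eigenspace (A : H →ₗ.[ℝ] H) (a : ℝ) : Submodule ℝ A.domain :=
  LinearMap.ker (A.toFun - a • A.domain.subtype)

/-- `ev 0 ≤ ev 1 ≤ …` is the list `0 ≤ λ₁ ≤ λ₂ ≤ … ↗ ∞` of all eigenvalues of `A`, repeated
according to geometric multiplicity (so `ev n` is `λ_{n+1}`). -/
structure IsEigenvalueEnumeration (A : H →ₗ.[ℝ] H) (ev : ℕ → ℝ) : Prop where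
  nonneg : ∀ n, 0 ≤ ev n
  mono : Monotone ev
  tendsto : Tendsto ev atTop atTop
  mult : ∀ a : ℝ, FiniteDimensional ℝ (eigenspace A a) ∧
    Module.finrank ℝ (eigenspace A a) = {n | ev n = a}.ncard

/-- The eigenvalue counting function `N_A(x) = max {n : λ_n ≤ x}`, that is, the number of
indices with `λ_n ≤ x`. -/
def eigenCount (ev : ℕ → ℝ) (x : ℝ) : ℕ := {n | ev n ≤ x}.ncard

/-- `dim_S A = lim_{x → ∞} log N_A(x) / log x` exists and equals `d`. -/
def HasSpectralDimension (A : H →ₗ.[ℝ] H) (d : EReal) : Prop :=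
  ∃ ev : ℕ → ℝ, IsEigenvalueEnumeration A ev ∧
    Tendsto (fun x : ℝ => ((Real.log (eigenCount ev x) / Real.log x : ℝ) : EReal)) atTop (𝓝 d)

/-- `B = √A`: `B` is a positive self-adjoint operator with `B ∘ B = A`, domains included. -/
structure IsSqrt [CompleteSpace H] (B A : H →ₗ.[ℝ] H) : Prop where
  dense : Dense (B.domain : Set H)
  selfAdjoint : IsSelfAdjoint B
  nonneg : ∀ u : B.domain, 0 ≤ inner ℝ (B u) (u : H)
  sq : ∀ f g : H, (f, g) ∈ A.graph ↔ ∃ k : H, (f, k) ∈ B.graph ∧ (k, g) ∈ B.graph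

/-- Strongly continuous semigroups of contractions. -/
structure IsContractionSemigroup (T : ℝ≥0 → H →L[ℝ] H) : Prop where
  zero : T 0 = 1
  add : ∀ s t, T (s + t) = T s * T t
  contraction : ∀ t, ‖T t‖ ≤ 1
  strongCont : ∀ f : H, Tendsto (fun t => T t f) (𝓝[>] 0) (𝓝 f)

/-- `-A` is the infinitesimal generator of `T`: `f ∈ D(A)` and `A f = g` if and only if
`t⁻¹ (T_t f - f) → -g` as `t ↘ 0`. -/
def IsNegGenerator (A : H →ₗ.[ℝ] H) (T : ℝ≥0 → H →L[ℝ] H) : Prop :=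
  ∀ f g : H, (f, g) ∈ A.graph ↔
    Tendsto (fun t : ℝ≥0 => (t : ℝ)⁻¹ • (T t f - f)) (𝓝[>] 0) (𝓝 (-g))

end Operators

section Conditions

variable {X : Type*} [MetricSpace X] [MeasurableSpace X] {μ : Measure X}

/-- The form `⟨B u, B v⟩` with `B = √A` is regular: `D(B) ∩ C_c(X)` is dense in `C_c(X)` for the
sup-norm, and dense in `D(B)` for the graph norm `‖u‖ + ‖B u‖`. -/
structure IsRegularForm (B : Lp ℝ 2 μ →ₗ.[ℝ] Lp ℝ 2 μ) : Prop where
  dense_unif : ∀ (f : C_c(X, ℝ)) (ε : ℝ), 0 < ε →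
    ∃ (g : C_c(X, ℝ)) (v : B.domain), (v : Lp ℝ 2 μ) =ᵐ[μ] g ∧ ∀ x, |f x - g x| < ε
  dense_graph : ∀ (u : B.domain) (ε : ℝ), 0 < ε →
    ∃ (g : C_c(X, ℝ)) (v : B.domain), (v : Lp ℝ 2 μ) =ᵐ[μ] g ∧
      ‖((u - v : B.domain) : Lp ℝ 2 μ)‖ + ‖B (u - v)‖ < ε

/-- The standing assumptions on an operator `A` on `L²(X, μ)`. -/
structure OperatorConditions (A : Lp ℝ 2 μ →ₗ.[ℝ] Lp ℝ 2 μ) : Prop where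
  dense : Dense (A.domain : Set (Lp ℝ 2 μ))
  selfAdjoint : IsSelfAdjoint A
  spectrum_nonneg : ∀ z ∈ opSpectrum A, 0 ≤ z
  eigenvalues : ∃ ev : ℕ → ℝ, IsEigenvalueEnumeration A ev
  regular : ∃ B : Lp ℝ 2 μ →ₗ.[ℝ] Lp ℝ 2 μ, IsSqrt B A ∧ IsRegularForm B
  dissipative : ∀ (u : A.domain) (z : ℝ), 0 < z →
    z * ‖(u : Lp ℝ 2 μ)‖ ≤ ‖z • (u : Lp ℝ 2 μ) + A u‖

end Conditions

/-! ### Hunt processes -/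

/-- `X_* = X ⊔ {*}` is Mathlib's `OnePoint X` (the one-point compactification for non-compact `X`;
the added point is isolated for compact `X`), with its Borel σ-algebra. -/
instance instMeasurableSpaceOnePoint {X : Type*} [TopologicalSpace X] :
    MeasurableSpace (OnePoint X) := borel _

instance instBorelSpaceOnePoint {X : Type*} [TopologicalSpace X] : BorelSpace (OnePoint X) := ⟨rfl⟩

/-- The intersection of the completions of a σ-algebra `m` with respect to all probability
measures on `(Ω, m𝒜)`. -/
@[reducible]
def universalCompletion {Ω : Type*} (m𝒜 m : MeasurableSpace Ω) : MeasurableSpace Ω where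
  MeasurableSet' s := ∀ P : @Measure Ω m𝒜, @IsProbabilityMeasure Ω m𝒜 P →
    ∃ a b : Set Ω, MeasurableSet[m] a ∧ MeasurableSet[m] b ∧ a ⊆ s ∧ s ⊆ b ∧ P (b \ a) = 0
  measurableSet_empty := fun P _ =>
    ⟨∅, ∅, @MeasurableSet.empty _ m, @MeasurableSet.empty _ m, le_rfl, le_rfl, by simp⟩
  measurableSet_compl := fun s hs P hP => by
    obtain ⟨a, b, ha, hb, has, hsb, h0⟩ := hs P hP
    refine ⟨bᶜ, aᶜ, @MeasurableSet.compl _ b m hb, @MeasurableSet.compl _ a m ha,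
      compl_subset_compl.2 hsb, compl_subset_compl.2 has, ?_⟩
    rwa [sdiff_compl, inter_comm, ← sdiff_eq]
  measurableSet_iUnion := fun s hs P hP => by
    choose a b ha hb has hsb h0 using fun i => hs i P hP
    refine ⟨⋃ i, a i, ⋃ i, b i, @MeasurableSet.iUnion _ _ m _ _ ha,
      @MeasurableSet.iUnion _ _ m _ _ hb, iUnion_mono has, iUnion_mono hsb, ?_⟩
    refine measure_mono_null (t := ⋃ i, b i \ a i) ?_ (measure_iUnion_null h0)
    rintro ω ⟨hω, hω'⟩
    obtain ⟨i, hi⟩ := mem_iUnion.1 hω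
    exact mem_iUnion.2 ⟨i, hi, fun h => hω' (mem_iUnion.2 ⟨i, h⟩)⟩

lemma universalCompletion_mono {Ω : Type*} (m𝒜 : MeasurableSpace Ω) {m m' : MeasurableSpace Ω}
    (h : m ≤ m') : universalCompletion m𝒜 m ≤ universalCompletion m𝒜 m' := by
  intro s hs P hP
  obtain ⟨a, b, ha, hb, r⟩ := hs P hP
  exact ⟨a, b, h _ ha, h _ hb, r⟩

/-- The σ-algebra `σ{M_s : 0 ≤ s ≤ t}`. -/
@[reducible]
def pastSigma {Ω S : Type*} [mS : MeasurableSpace S] (M : ℝ≥0 → Ω → S) (t : ℝ≥0) :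
    MeasurableSpace Ω :=
  ⨆ s : Iic t, MeasurableSpace.comap (M s) mS

lemma pastSigma_mono {Ω S : Type*} [MeasurableSpace S] (M : ℝ≥0 → Ω → S) :
    Monotone (pastSigma M) := fun _ _ hst =>
  iSup_le fun u => le_iSup_of_le (ι := Iic _) ⟨u.1, u.2.trans hst⟩ le_rfl

/-- The filtration `F_t = ⋂_P (σ{M_s : 0 ≤ s ≤ t})^P` of a process `M`. The completed σ-algebras
may exceed the given σ-algebra on `Ω`, so the ambient σ-algebra is `⊤`. -/
def processFiltration {Ω S : Type*} [m𝒜 : MeasurableSpace Ω] [MeasurableSpace S]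
    (M : ℝ≥0 → Ω → S) : Filtration ℝ≥0 (⊤ : MeasurableSpace Ω) where
  seq t := universalCompletion m𝒜 (pastSigma M t)
  mono' := fun _ _ hst => universalCompletion_mono m𝒜 (pastSigma_mono M hst)
  le' := fun _ => le_top

/-- The value `M_{τ+t}` at a random time `τ` (only used where `τ < ∞`). -/
def atTime {Ω S : Type*} (M : ℝ≥0 → Ω → S) (τ : Ω → WithTop ℝ≥0) (t : ℝ≥0) (ω : Ω) : S :=
  M ((τ ω).untopD 0 + t) ω

/-- A Hunt process with state space `X_*` and sample space `Ω`: a time-homogeneous strong Markov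
process with right-continuous trajectories having left limits which is quasi-left-continuous.
`law x` is `P_x`, and `α.bind law` is `P_α` for an initial distribution `α`. -/
structure HuntProcess (X : Type*) [TopologicalSpace X] (Ω : Type*) [MeasurableSpace Ω] where
  path : ℝ≥0 → Ω → OnePoint X
  law : Kernel (OnePoint X) Ω
  isMarkovKernel_law : IsMarkovKernel law
  measurable_path : ∀ t, Measurable (path t)
  start : ∀ x : OnePoint X, ∀ᵐ ω ∂(law x), path 0 ω = x
  cemetery : ∀ t : ℝ≥0, ∀ᵐ ω ∂(law OnePoint.infty), path t ω = OnePoint.infty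
  rightCont : ∀ (ω : Ω) (t : ℝ≥0), ContinuousWithinAt (fun s => path s ω) (Ici t) t
  leftLim : ∀ (ω : Ω) (t : ℝ≥0), 0 < t →
    ∃ l : OnePoint X, Tendsto (fun s => path s ω) (𝓝[<] t) (𝓝 l)
  strongMarkov : ∀ (α : Measure (OnePoint X)), IsProbabilityMeasure α →
    ∀ (τ : Ω → WithTop ℝ≥0) (hτ : IsStoppingTime (processFiltration path) τ) (Λ : Set Ω),
    MeasurableSet[hτ.measurableSpace] Λ →
    ∀ (t : ℝ≥0) (E : Set (OnePoint X)), MeasurableSet E →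
      (α.bind law) (Λ ∩ {ω | τ ω < ⊤ ∧ atTime path τ t ω ∈ E}) =
        ∫⁻ ω in Λ ∩ {ω | τ ω < ⊤}, law (atTime path τ 0 ω) {ω' | path t ω' ∈ E} ∂(α.bind law)
  quasiLeftCont : ∀ (α : Measure (OnePoint X)), IsProbabilityMeasure α →
    ∀ (σ : ℕ → Ω → WithTop ℝ≥0) (τ : Ω → WithTop ℝ≥0),
    (∀ n, IsStoppingTime (processFiltration path) (σ n)) →
    IsStoppingTime (processFiltration path) τ →
    (∀ ω, Monotone fun n => σ n ω) → (∀ ω, IsLUB (range fun n => σ n ω) (τ ω)) →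
    ∀ᵐ ω ∂(α.bind law), τ ω < ⊤ →
      Tendsto (fun n => atTime path (σ n) 0 ω) atTop (𝓝 (atTime path τ 0 ω))

namespace HuntProcess

variable {X : Type*} [MetricSpace X] {Ω : Type*} [MeasurableSpace Ω]

/-- `E_x[f(M_t)]`, where `f : X → ℝ` is extended by `f(*) = 0`. -/
def expect (M : HuntProcess X Ω) (t : ℝ≥0) (f : X → ℝ) (x : X) : ℝ :=
  ∫ ω, (M.path t ω).elim 0 f ∂(M.law x)

/-- `M` is associated to `A`: the transition operators `f ↦ E_x[f(M_t)]` (on bounded Borel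
functions `f ∈ L²`) are given by the strongly continuous contraction semigroup on `L²(X, μ)` with
generator `-A`, i.e. the semigroup of the form `(u, v) ↦ ⟨√A u, √A v⟩`. -/
def IsAssociated [MeasurableSpace X] {μ : Measure X} (M : HuntProcess X Ω)
    (A : Lp ℝ 2 μ →ₗ.[ℝ] Lp ℝ 2 μ) : Prop :=
  ∃ T : ℝ≥0 → Lp ℝ 2 μ →L[ℝ] Lp ℝ 2 μ, IsContractionSemigroup T ∧ IsNegGenerator A T ∧
    ∀ (t : ℝ≥0) (f : X → ℝ) (hf : MemLp f 2 μ), Measurable f → (∃ K : ℝ, ∀ x, |f x| ≤ K) →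
      T t (hf.toLp f) =ᵐ[μ] M.expect t f

/-- The first exit time `τ(B(x, r)) = inf {t ≥ 0 : M_t ∉ B(x, r)}`, with `inf ∅ = ∞`. -/
def exitTime (M : HuntProcess X Ω) (x : X) (r : ℝ) (ω : Ω) : ℝ≥0∞ :=
  ⨅ (t : ℝ≥0) (_ : M.path t ω ∉ ((↑) : X → OnePoint X) '' Metric.ball x r), (t : ℝ≥0∞)

/-- The mean exit time `E_x[τ(B(x, r))]`. -/
def meanExitTime (M : HuntProcess X Ω) (x : X) (r : ℝ) : ℝ≥0∞ :=
  ∫⁻ ω, M.exitTime x r ω ∂(M.law x)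

/-- The local walk dimension `lim_{r ↘ 0} log E_x[τ(B(x, r))] / log r` at `x` exists and
equals `d`. -/
def HasWalkDimensionAt (M : HuntProcess X Ω) (x : X) (d : EReal) : Prop :=
  Tendsto (fun r : ℝ => ENNReal.log (M.meanExitTime x r) / (Real.log r : EReal)) (𝓝[>] 0) (𝓝 d)

/-- The local walk dimension exists and equals the constant `d` at `μ`-almost every point. -/
def HasWalkDimension [MeasurableSpace X] (M : HuntProcess X Ω) (μ : Measure X) (d : EReal) :
    Prop :=
  ∀ᵐ x ∂μ, M.HasWalkDimensionAt x d

end HuntProcess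

/-- The Einstein relation `dim_H X = c · dim_S(X, A) · dim_W(X, M)` with constant `c` for an
operator `A` on `L²(X, μ)` and a process `M`; the limits defining the dimensions are required to
exist. -/
def EinsteinRelation {X : Type*} [MetricSpace X] [MeasurableSpace X] {μ : Measure X}
    {Ω : Type*} [MeasurableSpace Ω] (A : Lp ℝ 2 μ →ₗ.[ℝ] Lp ℝ 2 μ) (M : HuntProcess X Ω) (c : ℝ) :
    Prop :=
  ∃ dS dW : EReal, HasSpectralDimension A dS ∧ M.HasWalkDimension μ dW ∧
    ((dimH (univ : Set X) : ℝ≥0∞) : EReal) = (c : EReal) * dS * dW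

end EinsteinRel

end

/-! The operator `h.transport A` is by definition the conjugate of `A` by the unitary pullback `U`,
i.e. `conjOp h.pullback A`. Self-adjointness, spectrum, eigenvalue multiplicities, square root,
dissipativity and the generated semigroup are Hilbert space notions, so they pass through `U`. Only
regularity of the form uses that `U` is composition with a homeomorphism. That homeomorphism also
carries `M` to a process on the same sample space with the same filtration, which is therefore Hunt
and associated to the conjugate.

Bi-Lipschitz maps preserve Hausdorff dimension and move balls to sets between balls of comparable
radii. A constant factor in the radius does not affect a logarithmic scaling exponent, so the image
of `M` has the walk dimension of `M`.

The main difficulty is an arbitrary process `N` associated to the transported operator, possibly on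
another sample space: association fixes transition probabilities only up to null sets, separately
for each time and function. The generator determines the semigroup
(`IsNegGenerator.semigroup_unique`), so a countable generating algebra and rational times leave a
single null set to avoid. From almost every start that set is not charged at rational times, and the
Markov property then gives equal laws at rational times (`cylinder_eq`,
`IsAssociated.ae_map_rational_path_eq`). Right-continuity bounds exit times by functionals of
rational times (`rationalExit_le_exitTime`). Mean exit times of two associated processes thus
dominate each other after enlarging the radius, and the exponents agree. -/

noncomputable section

namespace EinsteinRel

/-! ### Unitary conjugation of partially defined operators -/

section Conjugation

variable {H K : Type*} [NormedAddCommGroup H] [InnerProductSpace ℝ H]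
  [NormedAddCommGroup K] [InnerProductSpace ℝ K]

/-- The operator `U⁻¹ A U` with domain `U⁻¹ (D(A))`. -/
def conjOp (U : K ≃ₗᵢ[ℝ] H) (A : H →ₗ.[ℝ] H) : K →ₗ.[ℝ] K where
  domain := A.domain.comap (U.toLinearEquiv : K →ₗ[ℝ] H)
  toFun := (U.symm.toLinearEquiv : H →ₗ[ℝ] K) ∘ₗ A.toFun ∘ₗ
    (U.toLinearEquiv : K →ₗ[ℝ] H).restrict (fun _ hf => hf)

variable (U : K ≃ₗᵢ[ℝ] H) {A B : H →ₗ.[ℝ] H}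

lemma mem_conjOp_domain {f : K} : f ∈ (conjOp U A).domain ↔ U f ∈ A.domain := Iff.rfl

lemma conjOp_apply (u : (conjOp U A).domain) :
    conjOp U A u = U.symm (A ⟨U u, u.2⟩) := rfl

lemma mem_conjOp_graph {f g : K} : (f, g) ∈ (conjOp U A).graph ↔ (U f, U g) ∈ A.graph := by
  simp only [LinearPMap.mem_graph_iff]
  constructor
  · rintro ⟨u, rfl, h⟩
    exact ⟨⟨U u, u.2⟩, rfl, by rw [← h, conjOp_apply]; simp⟩
  · rintro ⟨u, hu, h⟩
    refine ⟨⟨f, (mem_conjOp_domain U).2 (hu ▸ u.2)⟩, rfl, ?_⟩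
    rw [conjOp_apply, LinearIsometryEquiv.symm_apply_eq, ← h]
    exact congrArg A (Subtype.ext hu.symm)

lemma dense_conjOp_domain (h : Dense (A.domain : Set H)) :
    Dense ((conjOp U A).domain : Set K) :=
  h.preimage U.toHomeomorph.isOpenMap

/-- For dense domain the graph of the adjoint is the adjoint of the graph. This form involves only
graphs and inner products, both of which `U` transports directly. -/
lemma isSelfAdjoint_iff_mem_graph [CompleteSpace H] (hd : Dense (A.domain : Set H)) :
    IsSelfAdjoint A ↔ ∀ f g : H, (f, g) ∈ A.graph ↔
      ∀ a b, (a, b) ∈ A.graph → inner ℝ b f = inner ℝ a g := by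
  have hg : ∀ f g : H, (f, g) ∈ (LinearPMap.adjoint A).graph ↔
      ∀ a b, (a, b) ∈ A.graph → inner ℝ b f = inner ℝ a g := fun f g => by
    rw [LinearPMap.adjoint_graph_eq_graph_adjoint hd, Submodule.mem_adjoint_iff]
    simp only [sub_eq_zero]
  rw [LinearPMap.isSelfAdjoint_def]
  constructor
  · intro h f g
    rw [← hg f g, h]
  · intro h
    refine LinearPMap.eq_of_eq_graph (Submodule.ext fun p => ?_)
    rw [← Prod.mk.eta (p := p), hg, ← h]

lemma isSelfAdjoint_conjOp [CompleteSpace H] [CompleteSpace K] (hA : IsSelfAdjoint A) :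
    IsSelfAdjoint (conjOp U A) := by
  have hd := hA.dense_domain
  rw [isSelfAdjoint_iff_mem_graph (dense_conjOp_domain U hd)]
  intro f g
  rw [mem_conjOp_graph, (isSelfAdjoint_iff_mem_graph hd).1 hA]
  constructor
  · intro h a b hab
    rw [← U.inner_map_map, ← U.inner_map_map]
    exact h _ _ ((mem_conjOp_graph U).1 hab)
  · intro h a b hab
    have := h (U.symm a) (U.symm b) ((mem_conjOp_graph U).2 (by simpa using hab))
    rw [← U.inner_map_map, ← U.inner_map_map] at this
    simpa using this

/-- The resolvent is conjugated along with the operator. This direction suffices to see that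
conjugation creates no new spectrum. -/
lemma IsResolventPoint.conjOp {z : ℝ} (h : IsResolventPoint A z) :
    IsResolventPoint (conjOp U A) z := by
  obtain ⟨R, hR, hR'⟩ := h
  refine ⟨(U.symm : H →L[ℝ] K) ∘L R ∘L (U : K →L[ℝ] H), fun f => ?_, fun u => ?_⟩
  · obtain ⟨hf, hf'⟩ := hR (U f)
    refine ⟨?_, ?_⟩
    · rw [mem_conjOp_domain]
      simpa using hf
    · rw [conjOp_apply]
      apply U.injective
      simpa using hf'
  · have := hR' ⟨U u, u.2⟩
    rw [conjOp_apply]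
    apply U.injective
    simpa using this

lemma mem_eigenspace {a : ℝ} {u : A.domain} : u ∈ eigenspace A a ↔ A u = a • (u : H) := by
  rw [eigenspace, LinearMap.mem_ker, LinearMap.sub_apply, sub_eq_zero]
  rfl

/-- Conjugation identifies the eigenspaces. -/
def eigenspaceConjOpEquiv (a : ℝ) : eigenspace (conjOp U A) a ≃ₗ[ℝ] eigenspace A a where
  toFun u := ⟨⟨U (u : (conjOp U A).domain), u.1.2⟩, by
    have := mem_eigenspace.1 u.2
    rw [conjOp_apply, LinearIsometryEquiv.symm_apply_eq] at this
    rw [mem_eigenspace, this, map_smul]⟩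
  invFun u := ⟨⟨U.symm (u : A.domain), by rw [mem_conjOp_domain]; simp⟩, by
    have := mem_eigenspace.1 u.2
    rw [mem_eigenspace, conjOp_apply, LinearIsometryEquiv.symm_apply_eq]
    simpa using this⟩
  map_add' u v := by ext; simp
  map_smul' r u := by ext; simp
  left_inv u := by ext; simp
  right_inv u := by ext; simp

lemma isEigenvalueEnumeration_conjOp {ev : ℕ → ℝ} :
    IsEigenvalueEnumeration (conjOp U A) ev ↔ IsEigenvalueEnumeration A ev := by
  have key : ∀ a : ℝ, (FiniteDimensional ℝ (eigenspace (conjOp U A) a) ∧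
      Module.finrank ℝ (eigenspace (conjOp U A) a) = {n | ev n = a}.ncard) ↔
      (FiniteDimensional ℝ (eigenspace A a) ∧
      Module.finrank ℝ (eigenspace A a) = {n | ev n = a}.ncard) := fun a => by
    rw [(eigenspaceConjOpEquiv U a).finrank_eq]
    exact and_congr_left fun _ => ⟨fun _ => (eigenspaceConjOpEquiv U a).finiteDimensional,
      fun _ => (eigenspaceConjOpEquiv U (A := A) a).symm.finiteDimensional⟩
  exact ⟨fun h => ⟨h.nonneg, h.mono, h.tendsto, fun a => (key a).1 (h.mult a)⟩,
    fun h => ⟨h.nonneg, h.mono, h.tendsto, fun a => (key a).2 (h.mult a)⟩⟩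

lemma hasSpectralDimension_conjOp {d : EReal} :
    HasSpectralDimension (conjOp U A) d ↔ HasSpectralDimension A d := by
  simp only [HasSpectralDimension, isEigenvalueEnumeration_conjOp]

lemma IsSqrt.conjOp [CompleteSpace H] [CompleteSpace K] (h : IsSqrt B A) :
    IsSqrt (conjOp U B) (conjOp U A) where
  dense := dense_conjOp_domain U h.dense
  selfAdjoint := isSelfAdjoint_conjOp U h.selfAdjoint
  nonneg u := by
    rw [conjOp_apply, ← U.inner_map_map]
    simpa using h.nonneg ⟨U u, u.2⟩
  sq f g := by
    simp only [mem_conjOp_graph, h.sq]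
    constructor
    · rintro ⟨k, hk⟩
      exact ⟨U.symm k, by simpa using hk⟩
    · rintro ⟨k, hk⟩
      exact ⟨U k, hk⟩

/-- The semigroup `U⁻¹ T_t U`. -/
def conjSemigroup (T : ℝ≥0 → H →L[ℝ] H) (t : ℝ≥0) : K →L[ℝ] K :=
  (U.symm : H →L[ℝ] K) ∘L T t ∘L (U : K →L[ℝ] H)

lemma conjSemigroup_apply (T : ℝ≥0 → H →L[ℝ] H) (t : ℝ≥0) (f : K) :
    conjSemigroup U T t f = U.symm (T t (U f)) := rfl

lemma IsContractionSemigroup.conjSemigroup {T : ℝ≥0 → H →L[ℝ] H}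
    (h : IsContractionSemigroup T) : IsContractionSemigroup (conjSemigroup U T) where
  zero := by ext f; simp [conjSemigroup_apply, h.zero]
  add s t := by ext f; simp [conjSemigroup_apply, h.add]
  contraction t := by
    refine ContinuousLinearMap.opNorm_le_bound _ zero_le_one fun f => ?_
    rw [conjSemigroup_apply, LinearIsometryEquiv.norm_map, ← U.norm_map f]
    exact (T t).le_of_opNorm_le (h.contraction t) _
  strongCont f := by
    have := (U.symm.continuous.tendsto _).comp (h.strongCont (U f))
    simpa [Function.comp_def, conjSemigroup_apply] using this

lemma IsNegGenerator.conjOp {T : ℝ≥0 → H →L[ℝ] H} (h : IsNegGenerator A T) :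
    IsNegGenerator (conjOp U A) (conjSemigroup U T) := by
  intro f g
  rw [mem_conjOp_graph, h, U.toHomeomorph.isInducing.tendsto_nhds_iff]
  simp [Function.comp_def, conjSemigroup_apply]

end Conjugation

/-! ### A contraction semigroup is determined by its generator -/

section Semigroup

variable {H : Type*} [NormedAddCommGroup H] [InnerProductSpace ℝ H] {A : H →ₗ.[ℝ] H}
  {S T : ℝ≥0 → H →L[ℝ] H}

lemma IsContractionSemigroup.norm_apply_le (hT : IsContractionSemigroup T) (t : ℝ≥0) (f : H) :
    ‖T t f‖ ≤ ‖f‖ := by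
  simpa using (T t).le_of_opNorm_le (hT.contraction t) f

/-- Since `T t - T s = T s (T (t - s) - 1)`, continuity at time zero controls all times. -/
lemma IsContractionSemigroup.norm_sub_le (hT : IsContractionSemigroup T) {s t : ℝ≥0}
    (hst : s ≤ t) (f : H) : ‖T t f - T s f‖ ≤ ‖T (t - s) f - f‖ := by
  have h : T t f = T s (T (t - s) f) := by
    conv_lhs => rw [← add_tsub_cancel_of_le hst, hT.add]
    rfl
  rw [h, ← map_sub]
  exact hT.norm_apply_le _ _

lemma IsContractionSemigroup.continuous_apply (hT : IsContractionSemigroup T) (f : H) :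
    Continuous fun t => T t f := by
  have h0 : Tendsto (fun h => ‖T h f - f‖) (𝓝 0) (𝓝 0) := by
    have h1 : ContinuousWithinAt (fun t => T t f) (Ioi 0) 0 := by
      simpa [ContinuousWithinAt, hT.zero] using hT.strongCont f
    have h2 : ContinuousAt (fun t => T t f) 0 := by
      have := h1.insert
      rwa [Ioi_insert, show (Ici (0 : ℝ≥0)) = univ from Ici_bot, continuousWithinAt_univ] at this
    have := (h2.sub_const f).norm
    simpa [ContinuousAt, hT.zero] using this
  rw [continuous_iff_continuousAt]
  intro t
  rw [ContinuousAt, tendsto_iff_norm_sub_tendsto_zero]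
  -- With truncated subtraction one summand vanishes, so the sum is `|s - t|`.
  have h3 : Tendsto (fun s : ℝ≥0 => (s - t) + (t - s)) (𝓝 t) (𝓝 0) := by
    have : Continuous fun s : ℝ≥0 => (s - t) + (t - s) := by fun_prop
    simpa using this.tendsto t
  refine squeeze_zero (fun _ => norm_nonneg _) (fun s => ?_) (h0.comp h3)
  rcases le_total s t with h | h
  · rw [norm_sub_rev]
    simpa [tsub_eq_zero_of_le h] using hT.norm_sub_le h f
  · simpa [tsub_eq_zero_of_le h] using hT.norm_sub_le h f

/-- The negative of the generator of a contraction semigroup is accretive. -/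
lemma IsNegGenerator.inner_nonneg (hA : IsNegGenerator A T) (hT : IsContractionSemigroup T)
    {f g : H} (h : (f, g) ∈ A.graph) : 0 ≤ inner ℝ g f := by
  have h1 : Tendsto (fun t : ℝ≥0 => inner ℝ ((t : ℝ)⁻¹ • (T t f - f)) f) (𝓝[>] 0)
      (𝓝 (inner ℝ (-g) f)) := ((hA f g).1 h).inner tendsto_const_nhds
  have h2 : inner ℝ (-g) f ≤ 0 := by
    -- By Cauchy–Schwarz and contractivity, `⟨T t f, f⟩ ≤ ‖f‖²`, so each difference quotient already
    -- has the right sign.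
    refine le_of_tendsto h1 (Eventually.of_forall fun t => ?_)
    rw [real_inner_smul_left, inner_sub_left, real_inner_self_eq_norm_sq]
    refine mul_nonpos_of_nonneg_of_nonpos (by positivity) ?_
    have h3 := real_inner_le_norm (T t f) f
    have h4 := mul_le_mul_of_nonneg_right (hT.norm_apply_le t f) (norm_nonneg f)
    nlinarith
  rw [inner_neg_left] at h2
  linarith

lemma IsNegGenerator.apply_mem_graph (hA : IsNegGenerator A T) (hT : IsContractionSemigroup T)
    {f g : H} (h : (f, g) ∈ A.graph) (t : ℝ≥0) : (T t f, T t g) ∈ A.graph := by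
  rw [hA]
  have h1 := ((T t).continuous.tendsto _).comp ((hA f g).1 h)
  have h2 : ∀ s, T s (T t f) = T t (T s f) := fun s => by
    rw [← mul_apply_eq_comp, ← mul_apply_eq_comp, ← hT.add, ← hT.add,
      add_comm]
  simpa [Function.comp_def, h2] using h1

/-- The slope from `t` to `s` is the generator's difference quotient at `T t f`, with step `s - t`.
A right derivative is enough for the monotonicity argument in `semigroup_unique`. -/
lemma IsNegGenerator.hasDerivWithinAt (hA : IsNegGenerator A T) (hT : IsContractionSemigroup T)
    {f g : H} (h : (f, g) ∈ A.graph) {t : ℝ} (ht : 0 ≤ t) :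
    HasDerivWithinAt (fun s : ℝ => T s.toNNReal f) (-T t.toNNReal g) (Ici t) t := by
  rw [← hasDerivWithinAt_Ioi_iff_Ici, hasDerivWithinAt_iff_tendsto_slope' (by simp)]
  have h1 := (hA _ _).1 (hA.apply_mem_graph hT h t.toNNReal)
  have h2 : Tendsto (fun s : ℝ => (s - t).toNNReal) (𝓝[>] t) (𝓝[>] 0) := by
    refine tendsto_nhdsWithin_iff.2 ⟨?_, ?_⟩
    · have : Continuous fun s : ℝ => (s - t).toNNReal := by fun_prop
      have h3 := this.tendsto t
      simp only [sub_self, Real.toNNReal_zero] at h3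
      exact h3.mono_left nhdsWithin_le_nhds
    · filter_upwards [self_mem_nhdsWithin] with s hs
      simpa using hs
  refine (h1.comp h2).congr' ?_
  filter_upwards [self_mem_nhdsWithin] with s hs
  have hs' : 0 ≤ s - t := sub_nonneg.2 (le_of_lt hs)
  have h4 : s.toNNReal = (s - t).toNNReal + t.toNNReal := by
    rw [← Real.toNNReal_add hs' ht, sub_add_cancel]
  simp only [Function.comp_apply, slope, vsub_eq_sub, Real.coe_toNNReal _ hs']
  rw [h4, hT.add]
  rfl

/-- A strongly continuous contraction semigroup is determined by its generator. -/
lemma IsNegGenerator.semigroup_unique (hd : Dense (A.domain : Set H))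
    (hS : IsContractionSemigroup S) (hAS : IsNegGenerator A S)
    (hT : IsContractionSemigroup T) (hAT : IsNegGenerator A T) : S = T := by
  funext t
  refine ContinuousLinearMap.ext_on (s := (A.domain : Set H)) (by
    rwa [Submodule.span_eq]) fun f hf => ?_
  have hg : (f, A ⟨f, hf⟩) ∈ A.graph := A.mem_graph ⟨f, hf⟩
  set g := A ⟨f, hf⟩
  have hder : ∀ s : ℝ, 0 ≤ s → HasDerivWithinAt
      (fun r : ℝ => S r.toNNReal f - T r.toNNReal f)
      (-(S s.toNNReal g - T s.toNNReal g)) (Ici s) s := fun s hs => by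
    have := (hAS.hasDerivWithinAt hS hg hs).sub (hAT.hasDerivWithinAt hT hg hs)
    exact this.congr_deriv (by abel)
  have hcont : Continuous (fun r : ℝ => S r.toNNReal f - T r.toNNReal f) :=
    ((hS.continuous_apply f).comp continuous_real_toNNReal).sub
      ((hT.continuous_apply f).comp continuous_real_toNNReal)
  -- Energy argument: `w = S r f - T r f` stays in the domain of `A`, and `‖w‖²` has right
  -- derivative `-2 ⟨A w, w⟩ ≤ 0` by accretivity. It starts at zero, hence vanishes.
  have key := image_le_of_deriv_right_le_deriv_boundary
    (f := fun r : ℝ => inner ℝ (S r.toNNReal f - T r.toNNReal f) (S r.toNNReal f - T r.toNNReal f))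
    (a := 0) (b := t) (B := fun _ => 0) (B' := fun _ => 0)
    (hcont.inner hcont).continuousOn
    (fun s hs => (hder s hs.1).inner ℝ (hder s hs.1)) (by simp [hS.zero, hT.zero])
    continuousOn_const (fun s _ => hasDerivWithinAt_const _ _ _) (fun s _ => by
      have h1 := hAS.inner_nonneg hS (A.graph.sub_mem (hAS.apply_mem_graph hS hg s.toNNReal)
        (hAT.apply_mem_graph hT hg s.toNNReal))
      simp only [inner_neg_left, inner_neg_right]
      rw [real_inner_comm (S s.toNNReal g - T s.toNNReal g)]
      have h2 := real_inner_comm (S s.toNNReal g - T s.toNNReal g)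
        (S s.toNNReal f - T s.toNNReal f)
      linarith)
    (right_mem_Icc.2 t.2)
  simp only [Real.toNNReal_coe] at key
  exact sub_eq_zero.1 (real_inner_self_nonpos.1 key)

end Semigroup

/-! ### The transported operator satisfies the standing assumptions -/

section TransportOperator

variable {X Y : Type*} [MetricSpace X] [MeasurableSpace X] [MetricSpace Y] [MeasurableSpace Y]
  [BorelSpace X] [BorelSpace Y] [CompleteSpace X] {φ : X → Y} {μ : Measure X} {ν : Measure Y}
  [ν.IsOpenPosMeasure]

namespace IsLipschitzIso

lemma coeFn_pullback (h : IsLipschitzIso φ μ ν) (f : Lp ℝ 2 ν) :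
    h.pullback f =ᵐ[μ] f ∘ φ :=
  Lp.coeFn_compMeasurePreserving f h.measurePreserving

lemma coeFn_pullback_symm (h : IsLipschitzIso φ μ ν) (f : Lp ℝ 2 μ) :
    h.pullback.symm f =ᵐ[ν] f ∘ h.homeomorph.symm := by
  have h1 := h.coeFn_pullback (h.pullback.symm f)
  rw [LinearIsometryEquiv.apply_symm_apply] at h1
  filter_upwards [h.measurePreserving_symm.quasiMeasurePreserving.ae h1] with y hy
  rw [Function.comp_apply, hy]
  exact congrArg _ (h.homeomorph.apply_symm_apply y).symm

lemma pullback_toLp (h : IsLipschitzIso φ μ ν) {f : Y → ℝ} (hf : MemLp f 2 ν) :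
    h.pullback (hf.toLp f) = (hf.comp_measurePreserving h.measurePreserving).toLp (f ∘ φ) := by
  apply Lp.ext
  refine (h.coeFn_pullback _).trans (EventuallyEq.trans ?_ (MemLp.coeFn_toLp _).symm)
  exact h.measurePreserving.quasiMeasurePreserving.ae_eq_comp hf.coeFn_toLp

end IsLipschitzIso

/-- Composition of a compactly supported function with a homeomorphism. -/
def compHomeomorph {X Y : Type*} [TopologicalSpace X] [TopologicalSpace Y] (e : X ≃ₜ Y)
    (f : C_c(Y, ℝ)) : C_c(X, ℝ) :=
  ⟨⟨f ∘ e, f.continuous.comp e.continuous⟩, f.hasCompactSupport.comp_homeomorph e⟩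

lemma compHomeomorph_apply {X Y : Type*} [TopologicalSpace X] [TopologicalSpace Y] (e : X ≃ₜ Y)
    (f : C_c(Y, ℝ)) (x : X) : compHomeomorph e f x = f (e x) := rfl

/-- Composition with a homeomorphism preserves compact supports and uniform distances, and the
unitary preserves graph norms, so approximants on `X` are carried to `Y`. -/
lemma IsRegularForm.conjOp {B : Lp ℝ 2 μ →ₗ.[ℝ] Lp ℝ 2 μ} (hB : IsRegularForm B)
    (h : IsLipschitzIso φ μ ν) : IsRegularForm (conjOp h.pullback B) := by
  have key : ∀ (g : C_c(X, ℝ)) (v : B.domain), (v : Lp ℝ 2 μ) =ᵐ[μ] g →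
      h.pullback.symm (v : Lp ℝ 2 μ) =ᵐ[ν] compHomeomorph h.homeomorph.symm g := by
    intro g v hv
    exact (h.coeFn_pullback_symm _).trans
      (h.measurePreserving_symm.quasiMeasurePreserving.ae_eq_comp hv)
  have hdom : ∀ v : B.domain, h.pullback.symm (v : Lp ℝ 2 μ) ∈
      (EinsteinRel.conjOp h.pullback B).domain := fun v => by rw [mem_conjOp_domain]; simp
  constructor
  · intro f ε hε
    obtain ⟨g, v, hv, hfg⟩ := hB.dense_unif (compHomeomorph h.homeomorph f) ε hε
    refine ⟨compHomeomorph h.homeomorph.symm g, ⟨_, hdom v⟩, key g v hv, fun y => ?_⟩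
    have := hfg (h.homeomorph.symm y)
    rwa [compHomeomorph_apply, Homeomorph.apply_symm_apply] at this
  · intro u ε hε
    obtain ⟨g, v, hv, huv⟩ := hB.dense_graph ⟨h.pullback u, u.2⟩ ε hε
    refine ⟨compHomeomorph h.homeomorph.symm g, ⟨_, hdom v⟩, key g v hv, ?_⟩
    rw [conjOp_apply, LinearIsometryEquiv.norm_map, ← h.pullback.norm_map]
    -- Stated for a variable `w` because the membership proof inside the subtype depends on it.
    have e : ∀ w : (EinsteinRel.conjOp h.pullback B).domain, w = u - ⟨_, hdom v⟩ →
        (⟨h.pullback w, w.2⟩ : B.domain) = ⟨h.pullback u, u.2⟩ - v := by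
      rintro w rfl
      ext1
      simp
    have e' := congrArg Subtype.val (e _ rfl)
    simp only at e'
    rw [e _ rfl, e']
    exact huv

lemma OperatorConditions.transport {A : Lp ℝ 2 μ →ₗ.[ℝ] Lp ℝ 2 μ} (hA : OperatorConditions A)
    (h : IsLipschitzIso φ μ ν) : OperatorConditions (h.transport A) where
  dense := dense_conjOp_domain h.pullback hA.dense
  selfAdjoint := isSelfAdjoint_conjOp h.pullback hA.selfAdjoint
  spectrum_nonneg z hz := hA.spectrum_nonneg z fun hz' => hz (hz'.conjOp h.pullback)
  eigenvalues := by
    obtain ⟨ev, hev⟩ := hA.eigenvalues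
    exact ⟨ev, (isEigenvalueEnumeration_conjOp h.pullback).2 hev⟩
  regular := by
    obtain ⟨B, hB, hB'⟩ := hA.regular
    exact ⟨conjOp h.pullback B, hB.conjOp h.pullback, hB'.conjOp h⟩
  dissipative u z hz := by
    have := hA.dissipative ⟨h.pullback u, u.2⟩ z hz
    change z * ‖(u : Lp ℝ 2 ν)‖ ≤ ‖z • (u : Lp ℝ 2 ν) + h.pullback.symm (A ⟨h.pullback u, u.2⟩)‖
    rw [← h.pullback.norm_map,
      ← h.pullback.norm_map (z • (u : Lp ℝ 2 ν) + _)]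
    simpa using this

end TransportOperator

/-! ### Image of a Hunt process under a homeomorphism -/

section Image

/-- A measurable isomorphism of state spaces neither loses nor adds information. Hence a process and
its image have the same stopping times. -/
lemma pastSigma_comp_measurableEquiv {Ω S S' : Type*} [MeasurableSpace S] [MeasurableSpace S']
    (M : ℝ≥0 → Ω → S) (e : S ≃ᵐ S') (t : ℝ≥0) :
    pastSigma (fun s ω => e (M s ω)) t = pastSigma M t := by
  refine iSup_congr fun s => ?_
  conv_rhs => rw [← e.measurableEmbedding.comap_eq, MeasurableSpace.comap_comp]
  rfl

lemma processFiltration_comp_measurableEquiv {Ω S S' : Type*} [MeasurableSpace Ω]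
    [MeasurableSpace S] [MeasurableSpace S'] (M : ℝ≥0 → Ω → S) (e : S ≃ᵐ S') :
    processFiltration (fun s ω => e (M s ω)) = processFiltration M := by
  ext t : 2
  change universalCompletion _ _ = universalCompletion _ _
  rw [pastSigma_comp_measurableEquiv]

lemma measurableSet_stoppingTime_congr {Ω ι : Type*} [Preorder ι] {m : MeasurableSpace Ω}
    {F G : Filtration ι m} (h : F = G) {τ : Ω → WithTop ι} (hF : IsStoppingTime F τ)
    (hG : IsStoppingTime G τ) {Λ : Set Ω} (hΛ : MeasurableSet[hF.measurableSpace] Λ) :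
    MeasurableSet[hG.measurableSpace] Λ := by
  subst h
  exact hΛ

/-- Starting the image process from `α` amounts to starting the original one from the pulled-back
distribution. This reduces its strong Markov property and quasi-left-continuity to those of `M`. -/
lemma bind_comap_kernel {S S' Ω : Type*} [MeasurableSpace S] [MeasurableSpace S']
    [MeasurableSpace Ω] (κ : Kernel S Ω) {g : S' → S} (hg : Measurable g) (α : Measure S') :
    α.bind (κ.comap g hg) = (α.map g).bind κ := by
  rw [Measure.bind, Measure.bind, Measure.map_map κ.measurable hg]
  rfl

/-- The image `e(M)` of a Hunt process under a homeomorphism, with `e(*) = *`. -/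
def HuntProcess.image {X Y Ω : Type*} [TopologicalSpace X] [TopologicalSpace Y]
    [MeasurableSpace Ω] (M : HuntProcess X Ω) (e : X ≃ₜ Y) : HuntProcess Y Ω where
  path t ω := e.onePointCongr (M.path t ω)
  law := M.law.comap e.onePointCongr.symm e.onePointCongr.symm.measurable
  isMarkovKernel_law := by
    have := M.isMarkovKernel_law
    infer_instance
  measurable_path t := e.onePointCongr.measurable.comp (M.measurable_path t)
  start y := by
    rw [Kernel.comap_apply]
    filter_upwards [M.start (e.onePointCongr.symm y)] with ω hω
    rw [hω, Homeomorph.apply_symm_apply]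
  cemetery t := by
    rw [Kernel.comap_apply]
    filter_upwards [M.cemetery t] with ω hω
    rw [hω]
    rfl
  rightCont ω t := e.onePointCongr.continuous.continuousAt.comp_continuousWithinAt (M.rightCont ω t)
  leftLim ω t ht := by
    obtain ⟨l, hl⟩ := M.leftLim ω t ht
    exact ⟨_, (e.onePointCongr.continuous.tendsto l).comp hl⟩
  strongMarkov α hα τ hτ Λ hΛ t E hE := by
    have hF := processFiltration_comp_measurableEquiv M.path e.onePointCongr.toMeasurableEquiv
    have hτ' : IsStoppingTime (processFiltration M.path) τ := hF ▸ hτ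
    rw [bind_comap_kernel]
    have := M.strongMarkov (α.map e.onePointCongr.symm)
      (Measure.isProbabilityMeasure_map e.onePointCongr.symm.measurable.aemeasurable) τ hτ' Λ
      (measurableSet_stoppingTime_congr hF hτ hτ' hΛ) t (e.onePointCongr ⁻¹' E)
      (e.onePointCongr.measurable hE)
    simp only [Kernel.comap_apply, atTime, Homeomorph.symm_apply_apply]
    exact this
  quasiLeftCont α hα σ τ hσ hτ hmono hlub := by
    have hF := processFiltration_comp_measurableEquiv M.path e.onePointCongr.toMeasurableEquiv
    have hτ' : IsStoppingTime (processFiltration M.path) τ := hF ▸ hτ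
    have hσ' : ∀ n, IsStoppingTime (processFiltration M.path) (σ n) := fun n => hF ▸ hσ n
    rw [bind_comap_kernel]
    filter_upwards [M.quasiLeftCont (α.map e.onePointCongr.symm)
      (Measure.isProbabilityMeasure_map e.onePointCongr.symm.measurable.aemeasurable) σ τ hσ' hτ'
      hmono hlub] with ω hω h
    exact (e.onePointCongr.continuous.tendsto _).comp (hω h)

variable {X Y Ω : Type*} [MetricSpace X] [MetricSpace Y] [MeasurableSpace Ω]

lemma HuntProcess.image_law_coe (M : HuntProcess X Ω) (e : X ≃ₜ Y) (x : OnePoint X) :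
    (M.image e).law (e.onePointCongr x) = M.law x := by
  rw [HuntProcess.image, Kernel.comap_apply, Homeomorph.symm_apply_apply]

lemma HuntProcess.image_expect (M : HuntProcess X Ω) (e : X ≃ₜ Y) (t : ℝ≥0) (f : Y → ℝ) (x : X) :
    (M.image e).expect t f (e x) = M.expect t (f ∘ e) x := by
  have h := M.image_law_coe e x
  rw [HuntProcess.expect, HuntProcess.expect]
  change (M.image e).law (e x : Y) = _ at h
  rw [h]
  congr 1
  funext ω
  change (e.onePointCongr (M.path t ω)).elim 0 f = _
  induction M.path t ω using OnePoint.rec <;> rfl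

variable [MeasurableSpace X] [BorelSpace X] [MeasurableSpace Y] [BorelSpace Y] [CompleteSpace X]
  {φ : X → Y} {μ : Measure X} {ν : Measure Y} [ν.IsOpenPosMeasure]

lemma HuntProcess.IsAssociated.image {A : Lp ℝ 2 μ →ₗ.[ℝ] Lp ℝ 2 μ} {M : HuntProcess X Ω}
    (hM : M.IsAssociated A) (h : IsLipschitzIso φ μ ν) :
    (M.image h.homeomorph).IsAssociated (h.transport A) := by
  obtain ⟨T, hT, hA, hf⟩ := hM
  refine ⟨conjSemigroup h.pullback T, hT.conjSemigroup _, hA.conjOp _, ?_⟩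
  rintro t f hf2 hfm ⟨K, hK⟩
  rw [conjSemigroup_apply, h.pullback_toLp]
  refine (h.coeFn_pullback_symm _).trans ?_
  have h1 := hf t (f ∘ φ) (hf2.comp_measurePreserving h.measurePreserving)
    (hfm.comp h.measurePreserving.measurable) ⟨K, fun x => hK _⟩
  filter_upwards [h.measurePreserving_symm.quasiMeasurePreserving.ae h1] with y hy
  rw [Function.comp_apply, hy]
  have h2 := M.image_expect h.homeomorph t f (h.homeomorph.symm y)
  rw [Homeomorph.apply_symm_apply] at h2
  exact h2.symm

end Image

/-! ### Two Hunt processes associated to the same operator have the same law at rational times -/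

section OnePointMeasure

variable {X : Type*} [TopologicalSpace X] [MeasurableSpace X] [BorelSpace X]

lemma measurableEmbedding_onePoint_coe :
    MeasurableEmbedding ((↑) : X → OnePoint X) :=
  OnePoint.isOpenEmbedding_coe.measurableEmbedding

/-- The mass at `*` is the complementary mass, so testing inside `X` suffices. Association gives
nothing more, since functions vanish at `*`. -/
lemma onePoint_measure_ext {P Q : Measure (OnePoint X)} [IsProbabilityMeasure P]
    [IsProbabilityMeasure Q] (C : Set (Set X)) (hC : IsPiSystem C) (huniv : univ ∈ C)
    (hgen : ‹MeasurableSpace X› = MeasurableSpace.generateFrom C)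
    (h : ∀ E ∈ C, P (((↑) : X → OnePoint X) '' E) = Q (((↑) : X → OnePoint X) '' E)) : P = Q := by
  have hemb := measurableEmbedding_onePoint_coe (X := X)
  have hcomap : P.comap ((↑) : X → OnePoint X) = Q.comap ((↑) : X → OnePoint X) := by
    have : IsFiniteMeasure (P.comap ((↑) : X → OnePoint X)) :=
      ⟨by rw [hemb.comap_apply]; exact measure_lt_top _ _⟩
    refine ext_of_generate_finite C hgen hC (fun E hE => ?_) ?_
    · rw [hemb.comap_apply, hemb.comap_apply, h E hE]
    · rw [hemb.comap_apply, hemb.comap_apply, h _ huniv]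
  have hr : ∀ E : Set (OnePoint X), P (E ∩ range ((↑) : X → OnePoint X)) =
      Q (E ∩ range ((↑) : X → OnePoint X)) := fun E => by
    have := congrArg (fun m => m (((↑) : X → OnePoint X) ⁻¹' E)) hcomap
    simp only [hemb.comap_apply, image_preimage_eq_inter_range] at this
    exact this
  have hinf : P {OnePoint.infty} = Q {OnePoint.infty} := by
    rw [← OnePoint.compl_range_coe, prob_compl_eq_one_sub hemb.measurableSet_range,
      prob_compl_eq_one_sub hemb.measurableSet_range]
    have := hr univ
    rw [univ_inter] at this
    rw [this]
  ext E hE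
  rw [← measure_inter_add_sdiff E hemb.measurableSet_range,
    ← measure_inter_add_sdiff (μ := Q) E hemb.measurableSet_range, hr, sdiff_eq,
    OnePoint.compl_range_coe]
  congr 1
  by_cases hm : OnePoint.infty ∈ E
  · rw [inter_eq_self_of_subset_right (singleton_subset_iff.2 hm), hinf]
  · rw [inter_singleton_eq_empty.2 hm, measure_empty, measure_empty]

end OnePointMeasure

lemma le_universalCompletion {Ω : Type*} (m𝒜 m : MeasurableSpace Ω) :
    m ≤ universalCompletion m𝒜 m :=
  fun s hs _ _ => ⟨s, s, hs, hs, le_rfl, le_rfl, by simp⟩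

namespace HuntProcess

/-- The simple Markov property. -/
lemma markov {X Ω : Type*} [TopologicalSpace X] [MeasurableSpace Ω] (M : HuntProcess X Ω)
    (x : OnePoint X) (u s : ℝ≥0) {Λ : Set Ω} (hΛ : MeasurableSet[pastSigma M.path u] Λ)
    {E : Set (OnePoint X)} (hE : MeasurableSet E) :
    M.law x (Λ ∩ {ω | M.path (u + s) ω ∈ E}) =
      ∫⁻ ω in Λ, M.law (M.path u ω) {ω' | M.path s ω' ∈ E} ∂(M.law x) := by
  have hτ : IsStoppingTime (processFiltration M.path) (fun _ => WithTop.some u) :=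
    isStoppingTime_const _ u
  have hu : MeasurableSet[processFiltration M.path u] Λ := le_universalCompletion _ _ _ hΛ
  have hΛ' : MeasurableSet[hτ.measurableSpace] Λ := by
    -- For the constant time `u`, the set `Λ ∩ {τ ≤ i}` is either `Λ` or empty.
    refine ⟨le_iSup (fun t => processFiltration M.path t) u _ hu, fun i => ?_⟩
    by_cases hi : u ≤ i
    · rw [show {ω : Ω | WithTop.some u ≤ WithTop.some i} = univ from
        eq_univ_of_forall fun _ => WithTop.coe_le_coe.2 hi, inter_univ]
      exact (processFiltration M.path).mono hi _ hu
    · rw [show {ω : Ω | WithTop.some u ≤ WithTop.some i} = ∅ from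
        eq_empty_of_forall_notMem fun _ h => hi (WithTop.coe_le_coe.1 h), inter_empty]
      exact @MeasurableSet.empty _ (processFiltration M.path i)
  have key := M.strongMarkov (Measure.dirac x) inferInstance _ hτ Λ hΛ' s E hE
  rw [Measure.dirac_bind M.law.measurable] at key
  have h1 : {ω : Ω | WithTop.some u < ⊤} = univ :=
    eq_univ_of_forall fun _ => WithTop.coe_lt_top u
  have h2 : {ω : Ω | WithTop.some u < ⊤ ∧ atTime M.path (fun _ => WithTop.some u) s ω ∈ E} =
      {ω | M.path (u + s) ω ∈ E} := by
    ext ω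
    exact and_iff_right (WithTop.coe_lt_top u)
  have h3 : ∀ ω, atTime M.path (fun _ => WithTop.some u) 0 ω = M.path u ω := fun ω => by
    change M.path (u + 0) ω = _
    rw [add_zero]
  simp only [h3] at key
  rwa [h1, h2, inter_univ] at key

variable {X : Type*} [MetricSpace X] {Ω Ω' : Type*} [MeasurableSpace Ω] [MeasurableSpace Ω']

instance isProbabilityMeasure_law (M : HuntProcess X Ω) (x : OnePoint X) :
    IsProbabilityMeasure (M.law x) :=
  M.isMarkovKernel_law.isProbabilityMeasure x

lemma map_path_infty (M : HuntProcess X Ω) (t : ℝ≥0) :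
    (M.law OnePoint.infty).map (M.path t) = Measure.dirac OnePoint.infty := by
  rw [Measure.map_congr (M.cemetery t), Measure.map_const, measure_univ, one_smul]

/-- An extra condition at a time already in `F` gives another cylinder over `F`, so an induction
hypothesis over all `E` also covers it. -/
lemma setOf_cylinder_update {Ω S ι : Type*} [DecidableEq ι] {F : Finset ι} {u : ι} (hu : u ∈ F)
    {w : ι → Ω → S} {E : ι → Set S} {G : Set S} :
    {ω | ∀ q ∈ F, w q ω ∈ Function.update E u (E u ∩ G) q} =
      w u ⁻¹' G ∩ {ω | ∀ q ∈ F, w q ω ∈ E q} := by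
  ext ω
  simp only [mem_ofPred_eq, mem_inter_iff, mem_preimage]
  constructor
  · intro h
    refine ⟨?_, fun q hq => ?_⟩
    · have := h u hu
      rw [Function.update_self] at this
      exact this.2
    · have := h q hq
      rcases eq_or_ne q u with rfl | hqu
      · rw [Function.update_self] at this
        exact this.1
      · rwa [Function.update_of_ne hqu] at this
  · rintro ⟨h1, h2⟩ q hq
    rcases eq_or_ne q u with rfl | hqu
    · rw [Function.update_self]
      exact ⟨h2 _ hq, h1⟩
    · rw [Function.update_of_ne hqu]
      exact h2 q hq

/-- The Markov property at the last time before `t` turns the new constraint into a transition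
probability, integrated against the law of that last position on the old cylinder. -/
lemma law_cylinder_insert (M : HuntProcess X Ω) (x : OnePoint X) {F : Finset ℚ≥0}
    (hne : F.Nonempty) {t : ℚ≥0} (ht : ∀ q ∈ F, q < t) {E : ℚ≥0 → Set (OnePoint X)}
    (hE : ∀ q, MeasurableSet (E q)) :
    M.law x {ω | ∀ q ∈ insert t F, M.path q ω ∈ E q} =
      ∫⁻ y, M.law y {ω' | M.path ((t - F.max' hne : ℚ≥0) : ℝ≥0) ω' ∈ E t}
        ∂(((M.law x).restrict {ω | ∀ q ∈ F, M.path q ω ∈ E q}).map (M.path (F.max' hne))) := by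
  set u := F.max' hne
  have hts : (t : ℝ≥0) = (u : ℝ≥0) + ((t - u : ℚ≥0) : ℝ≥0) := by
    rw [← NNRat.cast_add, add_tsub_cancel_of_le (ht u (F.max'_mem hne)).le]
  have hΛ : MeasurableSet[pastSigma M.path u] {ω | ∀ q ∈ F, M.path q ω ∈ E q} := by
    rw [show {ω | ∀ q ∈ F, M.path q ω ∈ E q} = ⋂ q ∈ F, M.path q ⁻¹' E q by
      ext; simp]
    refine MeasurableSet.biInter F.countable_toSet fun q hq => ?_
    have hqu : (q : ℝ≥0) ≤ u := NNRat.cast_le.2 (F.le_max' q hq)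
    exact (le_iSup (fun s : Iic (u : ℝ≥0) => MeasurableSpace.comap (M.path s) _)
      ⟨(q : ℝ≥0), hqu⟩) _ ⟨E q, hE q, rfl⟩
  have hm : Measurable fun y => M.law y {ω' | M.path ((t - u : ℚ≥0) : ℝ≥0) ω' ∈ E t} :=
    M.law.measurable_coe (M.measurable_path _ (hE t))
  rw [lintegral_map hm (M.measurable_path u), ← M.markov x u _ hΛ (hE t), ← hts]
  congr 1
  ext ω
  simp [and_comm]

/-- If the transition functions of two processes agree off a set `Z` which the first process,
started at `x`, does not charge at rational times, then the finite dimensional distributions at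
rational times agree. -/
lemma cylinder_eq {M : HuntProcess X Ω} {N : HuntProcess X Ω'} {x : OnePoint X}
    {Z : Set (OnePoint X)} (hZm : MeasurableSet Z)
    (hZ : ∀ y ∉ Z, ∀ q : ℚ≥0, (M.law y).map (M.path q) = (N.law y).map (N.path q))
    (hx : x ∉ Z) (hxZ : ∀ q : ℚ≥0, M.law x (M.path q ⁻¹' Z) = 0) (F : Finset ℚ≥0) :
    ∀ E : ℚ≥0 → Set (OnePoint X), (∀ q, MeasurableSet (E q)) →
      M.law x {ω | ∀ q ∈ F, M.path q ω ∈ E q} = N.law x {ω | ∀ q ∈ F, N.path q ω ∈ E q} := by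
  have htrans : ∀ y ∉ Z, ∀ (q : ℚ≥0) (G : Set (OnePoint X)), MeasurableSet G →
      M.law y {ω | M.path q ω ∈ G} = N.law y {ω | N.path q ω ∈ G} := fun y hy q G hG => by
    have := congrArg (fun m => m G) (hZ y hy q)
    simp only [Measure.map_apply (M.measurable_path q) hG,
      Measure.map_apply (N.measurable_path q) hG] at this
    exact this
  induction F using Finset.induction_on_max with
  | empty => intro E _; simp
  | insert t F hF ih =>
    intro E hE
    rcases F.eq_empty_or_nonempty with rfl | hne
    · simpa using htrans x hx t (E t) (hE t)
    set u := F.max' hne with hu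
    have huF : u ∈ F := F.max'_mem hne
    -- The induction hypothesis, with `G` intersected into the constraint at `u`, identifies the two
    -- integrating measures. Only `M` must then avoid `Z`.
    have hmeas : ((M.law x).restrict {ω | ∀ q ∈ F, M.path q ω ∈ E q}).map (M.path u) =
        ((N.law x).restrict {ω | ∀ q ∈ F, N.path q ω ∈ E q}).map (N.path u) := by
      ext G hG
      rw [Measure.map_apply (M.measurable_path u) hG, Measure.map_apply (N.measurable_path u) hG,
        Measure.restrict_apply (M.measurable_path u hG),
        Measure.restrict_apply (N.measurable_path u hG)]
      have := ih (Function.update E u (E u ∩ G)) (fun q => by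
        rcases eq_or_ne q u with rfl | hq
        · simpa using (hE _).inter hG
        · simpa [hq] using hE q)
      simp only [setOf_cylinder_update huF] at this
      exact this
    rw [M.law_cylinder_insert x hne hF hE, N.law_cylinder_insert x hne hF hE, ← hu, ← hmeas]
    refine lintegral_congr_ae ?_
    have hnull : ∀ᵐ y ∂(((M.law x).restrict {ω | ∀ q ∈ F, M.path q ω ∈ E q}).map (M.path u)),
        y ∉ Z := by
      rw [ae_iff]
      simp only [not_not, ofPred_mem_eq]
      rw [Measure.map_apply (M.measurable_path u) hZm]
      exact le_antisymm ((Measure.restrict_apply_le _ _).trans_eq (hxZ u)) zero_le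
    filter_upwards [hnull] with y hy
    exact htrans y hy (t - u) (E t) (hE t)

lemma map_rational_path_eq_of_cylinder_eq {M : HuntProcess X Ω}
    {N : HuntProcess X Ω'} {x : OnePoint X}
    (h : ∀ (F : Finset ℚ≥0) (E : ℚ≥0 → Set (OnePoint X)), (∀ q, MeasurableSet (E q)) →
      M.law x {ω | ∀ q ∈ F, M.path q ω ∈ E q} = N.law x {ω | ∀ q ∈ F, N.path q ω ∈ E q}) :
    (M.law x).map (fun ω (q : ℚ≥0) => M.path q ω) =
      (N.law x).map (fun ω (q : ℚ≥0) => N.path q ω) := by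
  have hM : Measurable fun ω (q : ℚ≥0) => M.path q ω :=
    measurable_pi_lambda _ fun q => M.measurable_path q
  have hN : Measurable fun ω (q : ℚ≥0) => N.path q ω :=
    measurable_pi_lambda _ fun q => N.measurable_path q
  have := Measure.isProbabilityMeasure_map (μ := M.law x) hM.aemeasurable
  have := Measure.isProbabilityMeasure_map (μ := N.law x) hN.aemeasurable
  refine ext_of_generate_finite _ generateFrom_squareCylinders.symm
    (isPiSystem_squareCylinders (fun _ => MeasurableSpace.isPiSystem_measurableSet)
      fun _ => MeasurableSet.univ (α := OnePoint X)) ?_ (by simp)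
  rintro _ ⟨F, E, hE, rfl⟩
  have hE' : ∀ q, MeasurableSet (E q) := fun q => hE q (mem_univ q)
  have hm : MeasurableSet ((F : Set ℚ≥0).pi E) :=
    MeasurableSet.pi F.countable_toSet fun q _ => hE' q
  rw [Measure.map_apply hM hm, Measure.map_apply hN hm]
  exact h F E hE'

/-! ### Exit times and rational times -/

/-- The first rational time at which a trajectory is outside `K`. -/
def rationalExit {S : Type*} (K : Set S) (w : ℚ≥0 → S) : ℝ≥0∞ :=
  ⨅ (q : ℚ≥0) (_ : w q ∉ K), ((q : ℝ≥0) : ℝ≥0∞)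

/-- A countable infimum of coordinate functionals is measurable, so its mean depends only on the law
at rational times. The exit time itself is only bounded by such functionals and needs no
measurability. -/
lemma measurable_rationalExit {S : Type*} [MeasurableSpace S] {K : Set S} (hK : MeasurableSet K) :
    Measurable (rationalExit K) := by
  classical
  refine Measurable.iInf fun q => ?_
  have : (fun w : ℚ≥0 → S => ⨅ (_ : w q ∉ K), ((q : ℝ≥0) : ℝ≥0∞)) =
      fun w => if w q ∈ K then ⊤ else ((q : ℝ≥0) : ℝ≥0∞) := by
    funext w
    by_cases h : w q ∈ K <;> simp [h]
  rw [this]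
  exact Measurable.ite (measurable_pi_apply q hK) measurable_const measurable_const

lemma exitTime_le_rationalExit (M : HuntProcess X Ω) (x : X) (r : ℝ) (ω : Ω) :
    M.exitTime x r ω ≤
      rationalExit (((↑) : X → OnePoint X) '' Metric.closedBall x r) fun q => M.path q ω :=
  le_iInf₂ fun q hq => iInf₂_le (q : ℝ≥0)
    fun h => hq (image_mono Metric.ball_subset_closedBall h)

/-- Compactness makes the complement of the closed ball open in `X_*`, including at `*`. A path
outside the larger ball at time `t` lies in this open set and, by right-continuity, stays there
briefly, thus at rational times arbitrarily close to `t`. -/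
lemma rationalExit_le_exitTime (M : HuntProcess X Ω) (x : X) {r r' : ℝ} (hr : r < r')
    (hc : IsCompact (Metric.closedBall x r)) (ω : Ω) :
    rationalExit (((↑) : X → OnePoint X) '' Metric.closedBall x r) (fun q => M.path q ω) ≤
      M.exitTime x r' ω := by
  refine le_iInf₂ fun t ht => le_of_forall_gt fun c hc' => ?_
  have hopen : IsOpen (((↑) : X → OnePoint X) '' Metric.closedBall x r)ᶜ :=
    OnePoint.isOpen_compl_image_coe.2 ⟨Metric.isClosed_closedBall, hc⟩
  have hmem : M.path t ω ∈ (((↑) : X → OnePoint X) '' Metric.closedBall x r)ᶜ :=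
    fun h => ht (image_mono (Metric.closedBall_subset_ball hr) h)
  have h1 : ∀ᶠ s in 𝓝[≥] t, M.path s ω ∈ (((↑) : X → OnePoint X) '' Metric.closedBall x r)ᶜ :=
    (M.rightCont ω t).eventually (hopen.mem_nhds hmem)
  have h2 : ∀ᶠ s : ℝ≥0 in 𝓝[≥] t, (s : ℝ≥0∞) < c :=
    (ENNReal.continuous_coe.tendsto t).eventually_lt_const hc' |>.filter_mono nhdsWithin_le_nhds
  obtain ⟨u, hu, hsub⟩ := (mem_nhdsGE_iff_exists_Ico_subset' (lt_add_one t)).1 (h1.and h2)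
  obtain ⟨q, htq, hqu⟩ := exists_rat_btwn (NNReal.coe_lt_coe.2 hu)
  have hq0 : 0 ≤ q := by
    have : (0 : ℝ) ≤ q := t.2.trans htq.le
    exact_mod_cast this
  lift q to ℚ≥0 using hq0
  have h := hsub (show (q : ℝ≥0) ∈ Ico t u from
    ⟨by exact_mod_cast htq.le, by exact_mod_cast hqu⟩)
  exact (iInf₂_le q h.1).trans_lt h.2

lemma expect_indicator [MeasurableSpace X] [BorelSpace X] (M : HuntProcess X Ω) (t : ℝ≥0)
    {E : Set X} (hE : MeasurableSet E) (x : X) :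
    M.expect t (E.indicator 1) x =
      (M.law x).real (M.path t ⁻¹' (((↑) : X → OnePoint X) '' E)) := by
  rw [expect, ← integral_indicator_one
    (M.measurable_path t (measurableEmbedding_onePoint_coe.measurableSet_image.2 hE))]
  congr 1
  funext ω
  change (M.path t ω).elim 0 (E.indicator 1) =
    (((↑) : X → OnePoint X) '' E).indicator 1 (M.path t ω)
  induction M.path t ω using OnePoint.rec with
  | infty => simp
  | coe y => by_cases hy : y ∈ E <;> simp [hy]

/-! ### From the common semigroup to almost everywhere equal laws -/

variable [MeasurableSpace X] [BorelSpace X] {μ : Measure X} {A : Lp ℝ 2 μ →ₗ.[ℝ] Lp ℝ 2 μ}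
  {M : HuntProcess X Ω} {N : HuntProcess X Ω'}

/-- The indicator of a null set is zero in `L²`, hence so is its image under the semigroup. -/
lemma IsAssociated.ae_law_null (hM : M.IsAssociated A) (t : ℝ≥0) {E : Set X}
    (hE : MeasurableSet E) (h0 : μ E = 0) :
    ∀ᵐ x : X ∂μ, M.law x (M.path t ⁻¹' (((↑) : X → OnePoint X) '' E)) = 0 := by
  obtain ⟨T, -, -, hT⟩ := hM
  have hmem : MemLp (E.indicator (1 : X → ℝ)) 2 μ :=
    memLp_indicator_const 2 hE 1 (Or.inr (by simp [h0]))
  have h1 := hT t _ hmem (measurable_one.indicator hE)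
    ⟨1, fun x => by by_cases hx : x ∈ E <;> simp [hx]⟩
  have h2 : hmem.toLp (E.indicator (1 : X → ℝ)) = 0 := by
    rw [← MemLp.toLp_zero MemLp.zero', MemLp.toLp_eq_toLp_iff]
    exact indicator_meas_zero h0
  rw [h2, map_zero] at h1
  filter_upwards [h1, Lp.coeFn_zero ℝ 2 μ] with x hx hx'
  rw [hx', M.expect_indicator t hE] at hx
  exact (measureReal_eq_zero_iff).1 hx.symm

/-- Both sides represent the same semigroup applied to the indicator of `E`, which is in `L²`
because `E` has finite measure. -/
lemma IsAssociated.ae_law_eq (hd : Dense (A.domain : Set (Lp ℝ 2 μ))) (hM : M.IsAssociated A)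
    (hN : N.IsAssociated A) (t : ℝ≥0) {E : Set X} (hE : MeasurableSet E) (hfin : μ E ≠ ∞) :
    ∀ᵐ x : X ∂μ, M.law x (M.path t ⁻¹' (((↑) : X → OnePoint X) '' E)) =
      N.law x (N.path t ⁻¹' (((↑) : X → OnePoint X) '' E)) := by
  obtain ⟨T, hT1, hT2, hT⟩ := hM
  obtain ⟨S, hS1, hS2, hS⟩ := hN
  obtain rfl := IsNegGenerator.semigroup_unique hd hT1 hT2 hS1 hS2
  have hmem : MemLp (E.indicator (1 : X → ℝ)) 2 μ := memLp_indicator_const 2 hE 1 (Or.inr hfin)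
  have hb : ∃ K : ℝ, ∀ x, |E.indicator (1 : X → ℝ) x| ≤ K :=
    ⟨1, fun x => by by_cases hx : x ∈ E <;> simp [hx]⟩
  filter_upwards [hT t _ hmem (measurable_one.indicator hE) hb,
    hS t _ hmem (measurable_one.indicator hE) hb] with x hx hx'
  rw [hx, M.expect_indicator t hE, N.expect_indicator t hE] at hx'
  exact (measureReal_eq_measureReal_iff).1 hx'

lemma IsAssociated.ae_map_path_eq [TopologicalSpace.SeparableSpace X] [IsLocallyFiniteMeasure μ]
    (hd : Dense (A.domain : Set (Lp ℝ 2 μ))) (hM : M.IsAssociated A)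
    (hN : N.IsAssociated A) (t : ℝ≥0) :
    ∀ᵐ x : X ∂μ, (M.law x).map (M.path t) = (N.law x).map (N.path t) := by
  have := UniformSpace.secondCountable_of_separable X
  set C := generateSetAlgebra (MeasurableSpace.countableGeneratingSet X) with hCdef
  have hCcount : C.Countable :=
    countable_generateSetAlgebra MeasurableSpace.countable_countableGeneratingSet
  have hCalg : IsSetAlgebra C := isSetAlgebra_generateSetAlgebra
  have hCgen : ‹MeasurableSpace X› = MeasurableSpace.generateFrom C := by
    rw [hCdef, generateFrom_generateSetAlgebra_eq,
      MeasurableSpace.generateFrom_countableGeneratingSet]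
  have hCmeas : ∀ E ∈ C, MeasurableSet E := fun E hE => by
    rw [hCgen]
    exact MeasurableSpace.measurableSet_generateFrom hE
  -- Countability of the algebra and of the exhaustion yields one null set for all test sets.
  -- Cutting by `spanningSets` makes their measures finite.
  have h1 : ∀ᵐ x : X ∂μ, ∀ E ∈ C, ∀ n : ℕ,
      M.law x (M.path t ⁻¹' (((↑) : X → OnePoint X) '' (E ∩ spanningSets μ n))) =
      N.law x (N.path t ⁻¹' (((↑) : X → OnePoint X) '' (E ∩ spanningSets μ n))) := by
    rw [ae_ball_iff hCcount]
    intro E hE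
    rw [ae_all_iff]
    intro n
    exact hM.ae_law_eq hd hN t ((hCmeas E hE).inter (measurableSet_spanningSets μ n))
      (measure_inter_lt_top_of_right_ne_top (measure_spanningSets_lt_top μ n).ne).ne
  filter_upwards [h1] with x hx
  have := Measure.isProbabilityMeasure_map (μ := M.law x) (M.measurable_path t).aemeasurable
  have := Measure.isProbabilityMeasure_map (μ := N.law x) (N.measurable_path t).aemeasurable
  refine onePoint_measure_ext C (fun s hs t ht _ => hCalg.inter_mem hs ht) hCalg.univ_mem hCgen
    fun E hE => ?_
  have hEm := measurableEmbedding_onePoint_coe.measurableSet_image.2 (hCmeas E hE)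
  rw [Measure.map_apply (M.measurable_path t) hEm, Measure.map_apply (N.measurable_path t) hEm]
  have hU : E = ⋃ n, E ∩ spanningSets μ n := by
    rw [← inter_iUnion, iUnion_spanningSets, inter_univ]
  have hmono : Monotone fun n => ((↑) : X → OnePoint X) '' (E ∩ spanningSets μ n) :=
    fun m n hmn => image_mono (inter_subset_inter_right _ (monotone_spanningSets μ hmn))
  rw [hU, image_iUnion, preimage_iUnion, preimage_iUnion,
    (show Monotone fun n => M.path t ⁻¹' (((↑) : X → OnePoint X) '' (E ∩ spanningSets μ n)) from
      fun m n hmn => preimage_mono (hmono hmn)).measure_iUnion,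
    (show Monotone fun n => N.path t ⁻¹' (((↑) : X → OnePoint X) '' (E ∩ spanningSets μ n)) from
      fun m n hmn => preimage_mono (hmono hmn)).measure_iUnion]
  exact iSup_congr fun n => hx E hE n

/-- Two Hunt processes associated to the same operator have, for almost every starting point, the
same law at rational times. -/
lemma IsAssociated.ae_map_rational_path_eq [TopologicalSpace.SeparableSpace X]
    [IsLocallyFiniteMeasure μ] (hd : Dense (A.domain : Set (Lp ℝ 2 μ))) (hM : M.IsAssociated A)
    (hN : N.IsAssociated A) :
    ∀ᵐ x : X ∂μ, (M.law x).map (fun ω (q : ℚ≥0) => M.path q ω) =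
      (N.law x).map (fun ω (q : ℚ≥0) => N.path q ω) := by
  have h1 : ∀ᵐ x : X ∂μ, ∀ q : ℚ≥0, (M.law x).map (M.path q) = (N.law x).map (N.path q) :=
    ae_all_iff.2 fun q => hM.ae_map_path_eq hd hN q
  -- The bad starting points are enlarged to a measurable null set, so that the probability of
  -- hitting it at a rational time can be computed.
  obtain ⟨Z, hZsub, hZm, hZ0⟩ := exists_measurable_superset_of_null (ae_iff.1 h1)
  have h2 : ∀ᵐ x : X ∂μ, ∀ q : ℚ≥0,
      M.law x (M.path q ⁻¹' (((↑) : X → OnePoint X) '' Z)) = 0 :=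
    ae_all_iff.2 fun q => hM.ae_law_null q hZm hZ0
  have h3 : ∀ᵐ x ∂μ, x ∉ Z := measure_eq_zero_iff_ae_notMem.1 hZ0
  have hZ' : ∀ y ∉ ((↑) : X → OnePoint X) '' Z, ∀ q : ℚ≥0,
      (M.law y).map (M.path q) = (N.law y).map (N.path q) := by
    intro y hy q
    induction y using OnePoint.rec with
    | infty => rw [M.map_path_infty, N.map_path_infty]
    | coe y =>
      by_contra hne
      exact hy ⟨y, hZsub fun h => hne (h q), rfl⟩
  filter_upwards [h2, h3] with x hx2 hx3
  refine map_rational_path_eq_of_cylinder_eq fun F => cylinder_eq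
    (measurableEmbedding_onePoint_coe.measurableSet_image.2 hZm) hZ' ?_ hx2 F
  rintro ⟨y, hy, hyx⟩
  exact hx3 (OnePoint.coe_injective hyx ▸ hy)

/-- For two Hunt processes associated to the same operator, the mean exit times from small balls
are comparable for almost every starting point. -/
lemma IsAssociated.ae_meanExitTime_le [TopologicalSpace.SeparableSpace X]
    [IsLocallyFiniteMeasure μ] (hd : Dense (A.domain : Set (Lp ℝ 2 μ))) (hM : M.IsAssociated A)
    (hN : N.IsAssociated A) :
    ∀ᵐ x : X ∂μ, ∀ r r' : ℝ, r < r' → IsCompact (Metric.closedBall x r) →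
      M.meanExitTime x r ≤ N.meanExitTime x r' := by
  filter_upwards [hM.ae_map_rational_path_eq hd hN] with x hx r r' hr hc
  have hKm := measurable_rationalExit (measurableEmbedding_onePoint_coe.measurableSet_image.2
    (Metric.isClosed_closedBall (x := x) (ε := r)).measurableSet)
  calc M.meanExitTime x r ≤ ∫⁻ ω, rationalExit (((↑) : X → OnePoint X) '' Metric.closedBall x r)
        (fun q => M.path q ω) ∂(M.law x) :=
        lintegral_mono fun ω => M.exitTime_le_rationalExit x r ω
    _ = ∫⁻ ω, rationalExit (((↑) : X → OnePoint X) '' Metric.closedBall x r)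
        (fun q => N.path q ω) ∂(N.law x) := by
        rw [← lintegral_map hKm (measurable_pi_lambda _ fun q => M.measurable_path q), hx,
          lintegral_map hKm (measurable_pi_lambda _ fun q => N.measurable_path q)]
    _ ≤ N.meanExitTime x r' := lintegral_mono fun ω => N.rationalExit_le_exitTime x hr hc ω

end HuntProcess

/-! ### Logarithmic scaling exponents -/

lemma tendsto_const_mul_nhdsGT_zero {k : ℝ} (hk : 0 < k) :
    Tendsto (fun r : ℝ => k * r) (𝓝[>] 0) (𝓝[>] 0) := by
  refine tendsto_nhdsWithin_iff.2 ⟨?_, ?_⟩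
  · have : Continuous fun r : ℝ => k * r := by fun_prop
    simpa using (this.tendsto 0).mono_left (nhdsWithin_le_nhds (s := Ioi 0))
  · filter_upwards [self_mem_nhdsWithin] with r hr
    exact mul_pos hk hr

/-- The factor `log (k r) / log r` tends to one, and multiplication on `EReal` is continuous at `(d,
1)` even for infinite `d`. -/
lemma tendsto_log_div_log_comp_mul {f : ℝ → ℝ≥0∞} {d : EReal} {k : ℝ} (hk : 0 < k)
    (h : Tendsto (fun r : ℝ => ENNReal.log (f r) / (Real.log r : EReal)) (𝓝[>] 0) (𝓝 d)) :
    Tendsto (fun r : ℝ => ENNReal.log (f (k * r)) / (Real.log r : EReal)) (𝓝[>] 0) (𝓝 d) := by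
  have hk0 := tendsto_const_mul_nhdsGT_zero hk
  have hratio : Tendsto (fun r : ℝ => Real.log (k * r) / Real.log r) (𝓝[>] 0) (𝓝 1) := by
    have h1 : Tendsto (fun r : ℝ => Real.log k / Real.log r) (𝓝[>] 0) (𝓝 0) :=
      tendsto_const_nhds.div_atBot Real.tendsto_log_nhdsGT_zero
    have h2 := h1.add_const 1
    rw [zero_add] at h2
    refine h2.congr' ?_
    filter_upwards [Ioo_mem_nhdsGT (zero_lt_one (α := ℝ))] with r hr
    have := (Real.log_neg hr.1 hr.2).ne
    rw [Real.log_mul hk.ne' hr.1.ne']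
    field_simp
  have hprod := Tendsto.comp (EReal.continuousAt_mul (p := (d, ((1 : ℝ) : EReal)))
    (Or.inr (EReal.coe_ne_bot 1)) (Or.inr (EReal.coe_ne_top 1)) (by simp) (by simp))
    ((h.comp hk0).prodMk_nhds ((continuous_coe_real_ereal.tendsto 1).comp hratio))
  simp only [EReal.coe_one, mul_one] at hprod
  refine hprod.congr' ?_
  filter_upwards [Ioo_mem_nhdsGT (zero_lt_one (α := ℝ)),
    hk0.eventually (Ioo_mem_nhdsGT (zero_lt_one (α := ℝ)))] with r hr hkr
  have h1 := (Real.log_neg hr.1 hr.2).ne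
  have h2 := (Real.log_neg hkr.1 hkr.2).ne
  simp only [Function.comp_apply, EReal.div_eq_inv_mul]
  rw [mul_comm, ← mul_assoc, ← EReal.coe_inv, ← EReal.coe_inv, ← EReal.coe_mul]
  congr 2
  field_simp

/-- Squeeze between rescalings of `f`. As `log r < 0` near zero, division reverses inequalities: `f
(C * r)` gives the lower bound and `f (C⁻¹ * r)` the upper one. -/
lemma tendsto_log_div_log_of_le {f g : ℝ → ℝ≥0∞} {d : EReal} {C : ℝ} (hC : 0 < C)
    (hfg : ∀ᶠ r in 𝓝[>] (0 : ℝ), f r ≤ g (C * r)) (hgf : ∀ᶠ r in 𝓝[>] (0 : ℝ), g r ≤ f (C * r))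
    (h : Tendsto (fun r : ℝ => ENNReal.log (f r) / (Real.log r : EReal)) (𝓝[>] 0) (𝓝 d)) :
    Tendsto (fun r : ℝ => ENNReal.log (g r) / (Real.log r : EReal)) (𝓝[>] 0) (𝓝 d) := by
  have hC0 := tendsto_const_mul_nhdsGT_zero (inv_pos.2 hC)
  have hneg : ∀ᶠ r in 𝓝[>] (0 : ℝ), ((Real.log r : ℝ) : EReal) ≤ 0 := by
    filter_upwards [Ioo_mem_nhdsGT (zero_lt_one (α := ℝ))] with r hr
    exact_mod_cast (Real.log_neg hr.1 hr.2).le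
  refine tendsto_of_tendsto_of_tendsto_of_le_of_le' (tendsto_log_div_log_comp_mul hC h)
    (tendsto_log_div_log_comp_mul (inv_pos.2 hC) h) ?_ ?_
  · filter_upwards [hgf, hneg] with r hr hlog
    exact EReal.antitone_div_right_of_nonpos hlog (ENNReal.log_le_log hr)
  · filter_upwards [hC0.eventually hfg, hneg] with r hr hlog
    rw [mul_inv_cancel_left₀ hC.ne'] at hr
    exact EReal.antitone_div_right_of_nonpos hlog (ENNReal.log_le_log hr)

lemma tendsto_log_div_log_iff_of_le {f g : ℝ → ℝ≥0∞} {d : EReal} {C : ℝ} (hC : 0 < C)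
    (hfg : ∀ᶠ r in 𝓝[>] (0 : ℝ), f r ≤ g (C * r)) (hgf : ∀ᶠ r in 𝓝[>] (0 : ℝ), g r ≤ f (C * r)) :
    Tendsto (fun r : ℝ => ENNReal.log (f r) / (Real.log r : EReal)) (𝓝[>] 0) (𝓝 d) ↔
    Tendsto (fun r : ℝ => ENNReal.log (g r) / (Real.log r : EReal)) (𝓝[>] 0) (𝓝 d) :=
  ⟨tendsto_log_div_log_of_le hC hfg hgf, tendsto_log_div_log_of_le hC hgf hfg⟩

/-! ### Invariance of the walk dimension -/

section WalkDimension

variable {X Y Ω Ω' : Type*} [MetricSpace X] [MetricSpace Y] [MeasurableSpace Ω]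
  [MeasurableSpace Ω']

namespace HuntProcess

/-- Pathwise on the common sample space: `e` maps `B(x, r)` into `B(e x, C r)`, so the image cannot
leave the latter earlier. -/
lemma exitTime_le_image_exitTime (M : HuntProcess X Ω) (e : X ≃ₜ Y) {C : ℝ} (hC : 0 < C)
    (h : ∀ x y, dist (e x) (e y) ≤ C * dist x y) (x : X) (r : ℝ) (ω : Ω) :
    M.exitTime x r ω ≤ (M.image e).exitTime (e x) (C * r) ω := by
  refine le_iInf₂ fun t ht => iInf₂_le t fun hm => ht ?_
  obtain ⟨z, hz, hzt⟩ := hm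
  refine ⟨e z, ?_, ?_⟩
  · exact (h z x).trans_lt (mul_lt_mul_of_pos_left hz hC)
  · change _ = e.onePointCongr (M.path t ω)
    rw [← hzt]
    rfl

lemma image_exitTime_le_exitTime (M : HuntProcess X Ω) (e : X ≃ₜ Y) {C : ℝ} (hC : 0 < C)
    (h : ∀ x y, dist x y ≤ C * dist (e x) (e y)) (x : X) (r : ℝ) (ω : Ω) :
    (M.image e).exitTime (e x) r ω ≤ M.exitTime x (C * r) ω := by
  refine le_iInf₂ fun t ht => iInf₂_le t fun hm => ht ?_
  obtain ⟨y, hy, hyt⟩ := hm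
  obtain ⟨z, rfl⟩ := e.surjective y
  refine ⟨z, (h z x).trans_lt (mul_lt_mul_of_pos_left hy hC), ?_⟩
  exact e.onePointCongr.injective hyt

lemma hasWalkDimensionAt_image (M : HuntProcess X Ω) (e : X ≃ₜ Y) {C : ℝ} (hC : 0 < C)
    (h : ∀ x y, dist (e x) (e y) ≤ C * dist x y) (h' : ∀ x y, dist x y ≤ C * dist (e x) (e y))
    (x : X) (d : EReal) :
    (M.image e).HasWalkDimensionAt (e x) d ↔ M.HasWalkDimensionAt x d := by
  have hlaw : (M.image e).law (e x : Y) = M.law x := M.image_law_coe e x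
  refine tendsto_log_div_log_iff_of_le hC (Eventually.of_forall fun r => ?_)
    (Eventually.of_forall fun r => ?_)
  · rw [meanExitTime, meanExitTime, hlaw]
    exact lintegral_mono fun ω => M.image_exitTime_le_exitTime e hC h' x r ω
  · rw [meanExitTime, meanExitTime, hlaw]
    exact lintegral_mono fun ω => M.exitTime_le_image_exitTime e hC h x r ω

/-- Two Hunt processes associated to the same operator have the same local walk dimension at
almost every point. -/
lemma IsAssociated.ae_hasWalkDimensionAt_iff [TopologicalSpace.SeparableSpace X]
    [LocallyCompactSpace X] [MeasurableSpace X] [BorelSpace X] {μ : Measure X}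
    [IsLocallyFiniteMeasure μ] {A : Lp ℝ 2 μ →ₗ.[ℝ] Lp ℝ 2 μ} {M : HuntProcess X Ω}
    {N : HuntProcess X Ω'} (hd : Dense (A.domain : Set (Lp ℝ 2 μ))) (hM : M.IsAssociated A)
    (hN : N.IsAssociated A) :
    ∀ᵐ x ∂μ, ∀ d : EReal, M.HasWalkDimensionAt x d ↔ N.HasWalkDimensionAt x d := by
  filter_upwards [hM.ae_meanExitTime_le hd hN, hN.ae_meanExitTime_le hd hM] with x h1 h2 d
  -- Local compactness makes all small closed balls at `x` compact. The factor 2 used below could be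
  -- any constant above one.
  obtain ⟨r₀, hr₀, hcomp⟩ := Metric.exists_isCompact_closedBall x
  have hball : ∀ᶠ r in 𝓝[>] (0 : ℝ), r < 2 * r ∧ IsCompact (Metric.closedBall x r) := by
    filter_upwards [Ioo_mem_nhdsGT hr₀] with r hr
    exact ⟨by linarith [hr.1], hcomp.of_isClosed_subset Metric.isClosed_closedBall
      (Metric.closedBall_subset_closedBall hr.2.le)⟩
  exact tendsto_log_div_log_iff_of_le two_pos
    (hball.mono fun r hr => h1 r (2 * r) hr.1 hr.2)
    (hball.mono fun r hr => h2 r (2 * r) hr.1 hr.2)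

end HuntProcess

variable [MeasurableSpace X] [MeasurableSpace Y] {μ : Measure X} {ν : Measure Y} {φ : X → Y}

lemma IsLipschitzIso.exists_dist_le (h : IsLipschitzIso φ μ ν) :
    ∃ C : ℝ, 0 < C ∧ (∀ x y, dist (φ x) (φ y) ≤ C * dist x y) ∧
      ∀ x y, dist x y ≤ C * dist (φ x) (φ y) := by
  obtain ⟨C, hC, hd⟩ := h.biLipschitz
  have hC0 : 0 < C := by linarith
  refine ⟨C, hC0, fun x y => (hd x y).2, fun x y => ?_⟩
  have := (hd x y).1
  rwa [one_div, inv_mul_le_iff₀ hC0] at this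

variable [CompleteSpace X] [BorelSpace X] [BorelSpace Y] [ν.IsOpenPosMeasure]

lemma IsLipschitzIso.ae_iff (h : IsLipschitzIso φ μ ν) {p : Y → Prop} :
    (∀ᵐ y ∂ν, p y) ↔ ∀ᵐ x ∂μ, p (h.homeomorph x) := by
  refine ⟨fun hp => h.measurePreserving.quasiMeasurePreserving.ae hp, fun hp => ?_⟩
  filter_upwards [h.measurePreserving_symm.quasiMeasurePreserving.ae hp] with y hy
  rwa [Homeomorph.apply_symm_apply] at hy

lemma IsLipschitzIso.dimH_univ_eq (h : IsLipschitzIso φ μ ν) :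
    dimH (univ : Set Y) = dimH (univ : Set X) := by
  obtain ⟨C, hC, h1, h2⟩ := h.exists_dist_le
  have hL : LipschitzWith C.toNNReal φ := LipschitzWith.of_dist_le_mul fun x y => by
    rw [Real.coe_toNNReal _ hC.le]
    exact h1 x y
  have hA : AntilipschitzWith C.toNNReal φ := AntilipschitzWith.of_le_mul_dist fun x y => by
    rw [Real.coe_toNNReal _ hC.le]
    exact h2 x y
  rw [← image_univ_of_surjective h.surjective]
  exact le_antisymm (hL.dimH_image_le _) (hA.le_dimH_image _)

/-- The image of `M` is the intermediary: it shares its operator with `N`, and its sample space and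
laws with `M`. -/
lemma IsLipschitzIso.hasWalkDimension_iff [TopologicalSpace.SeparableSpace Y]
    [LocallyCompactSpace Y] [IsLocallyFiniteMeasure ν] (h : IsLipschitzIso φ μ ν)
    {A : Lp ℝ 2 μ →ₗ.[ℝ] Lp ℝ 2 μ} (hd : Dense (A.domain : Set (Lp ℝ 2 μ)))
    {M : HuntProcess X Ω} (hM : M.IsAssociated A) {N : HuntProcess Y Ω'}
    (hN : N.IsAssociated (h.transport A)) (d : EReal) :
    N.HasWalkDimension ν d ↔ M.HasWalkDimension μ d := by
  obtain ⟨C, hC, h1, h2⟩ := h.exists_dist_le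
  have key := h.ae_iff.1 (hN.ae_hasWalkDimensionAt_iff
    (dense_conjOp_domain h.pullback hd) (hM.image h))
  rw [HuntProcess.HasWalkDimension, HuntProcess.HasWalkDimension, h.ae_iff]
  refine eventually_congr ?_
  filter_upwards [key] with x hx
  rw [hx, M.hasWalkDimensionAt_image h.homeomorph hC h1 h2]

end WalkDimension

end EinsteinRel

end

open EinsteinRel in
theorem mainTheorem1 {X Y Ω : Type*}
    [MetricSpace X] [CompleteSpace X] [TopologicalSpace.SeparableSpace X] [LocallyCompactSpace X]
    [PathConnectedSpace X] [MeasurableSpace X] [BorelSpace X]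
    [MetricSpace Y] [CompleteSpace Y] [TopologicalSpace.SeparableSpace Y] [LocallyCompactSpace Y]
    [PathConnectedSpace Y] [MeasurableSpace Y] [BorelSpace Y]
    (μ : Measure X) [IsLocallyFiniteMeasure μ] [μ.IsOpenPosMeasure]
    (ν : Measure Y) [IsLocallyFiniteMeasure ν] [ν.IsOpenPosMeasure]
    (φ : X → Y) (hφ : IsLipschitzIso φ μ ν)
    (A : Lp ℝ 2 μ →ₗ.[ℝ] Lp ℝ 2 μ) (hA : OperatorConditions A) (c : ℝ)
    [MeasurableSpace Ω] (M : HuntProcess X Ω) (hM : M.IsAssociated A)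
    (hE : EinsteinRelation A M c) :
    -- the transported operator satisfies the standing assumptions
    OperatorConditions (hφ.transport A) ∧
    -- the image process `φ(M)` is a Hunt process associated to the transported operator
    (∃ N : HuntProcess Y Ω,
      (∀ t ω, N.path t ω = (M.path t ω).map φ) ∧
      (∀ x : OnePoint X, N.law (x.map φ) = M.law x) ∧
      N.IsAssociated (hφ.transport A)) ∧
    -- the Hausdorff and the spectral dimension are preserved
    dimH (univ : Set Y) = dimH (univ : Set X) ∧
    (∀ d : EReal, HasSpectralDimension (hφ.transport A) d ↔ HasSpectralDimension A d) ∧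
    -- for every Hunt process associated to the transported operator, the walk dimension is
    -- that of `M` and the Einstein relation holds with the same constant
    ∀ {Ω' : Type*} [MeasurableSpace Ω'] (N : HuntProcess Y Ω'),
      N.IsAssociated (hφ.transport A) →
        (∀ d : EReal, N.HasWalkDimension ν d ↔ M.HasWalkDimension μ d) ∧
        EinsteinRelation (hφ.transport A) N c := by
  have hS : ∀ d : EReal, HasSpectralDimension (hφ.transport A) d ↔ HasSpectralDimension A d :=
    fun d => hasSpectralDimension_conjOp hφ.pullback
  refine ⟨hA.transport hφ, ⟨M.image hφ.homeomorph, fun _ _ => rfl,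
    M.image_law_coe hφ.homeomorph, hM.image hφ⟩, hφ.dimH_univ_eq, hS, fun N hN => ?_⟩
  have hW := hφ.hasWalkDimension_iff hA.dense hM hN
  refine ⟨hW, ?_⟩
  obtain ⟨dS, dW, h1, h2, h3⟩ := hE
  exact ⟨dS, dW, (hS dS).2 h1, (hW dW).2 h2, by rw [hφ.dimH_univ_eq, h3]⟩
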